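/- **Definitions.** Let $\pi$ be a permutation of $\{1,\dots,n\}$ (a permutation of length $n$). An *interval* of $\pi$ is a set $I$ of contiguous positions whose set of values $\pi(I)$ is also contiguous; $\pi$ is *simple* if its only intervals have length $0$, $1$ or $n$. The permutation $\pi$ *contains* a permutation $\sigma$ if some subsequence of $\pi$ is order isomorphic to $\sigma$. The *symmetries* of a permutation are its (at most eight) images under compositions of reverse, complement and inverse. *Proper pin sequences.* For a set $S$ of points in the plane let $\mathrm{rect}(S)$ be the smallest axes-parallel rectangle containing $S$. A *pin* for $S$ is a point outside $\mathrm{rect}(S)$ lying horizontally or vertically amongst the points of $S$; its direction (up, down, left or right) records its position relative to $\mathrm{rect}(S)$. A *proper pin sequence of length $m$* of $\pi$ is a sequence $p_1,\dots,p_m$ of distinct points of the plot $\{(i,\pi(i))\}$ such that, for every $i\ge 3$: (a) $p_i$ is a pin for $\{p_1,\dots,p_{i-1}\}$; (b) among all points of the plot that are pins for $\{p_1,\dots,p_{i-1}\}$ with the same direction as $p_i$, the point $p_i$ is furthest in that direction; (c) $p_i$ lies horizontally or vertically strictly between $p_{i-1}$ and $\mathrm{rect}(p_1,\dots,p_{i-2})$.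 *Parallel alternations.* A *horizontal alternation* is a permutation in which every odd entry lies to the left of every even entry, or the reverse of such a permutation. A *parallel alternation* is a horizontal alternation in which the odd entries and the even entries are both increasing or both decreasing from left to right, or the inverse of such a permutation. *Wedge simple permutations.* A *wedge simple permutation of length $2m$* is any symmetry of one of the two permutations of length $2m$ $$(m+1)\,(m-1)\,(m+2)\,(m-2)\cdots(2m-1)\;1\;(2m)\;m \quad\text{(type 1)},$$ $$m\,(2m)\,(m-1)\,(m+1)\,(m-2)\,(m+2)\cdots 1\,(2m-1)\quad\text{(type 2)}.$$ **Theorem (Brignall, Huczynska and Vatter).** Let $k$ be a non-negative integer (for $k=0$, with $0^0=1$, the claim is trivial). Let $\pi$ be a simple permutation of length $n\ge 2(256k^8)^{2k}$. Then $\pi$ has a proper pin sequence of length $2k$, or $\pi$ contains a parallel alternation of length $2k$, or $\pi$ contains a wedge simple permutation of length $2k$. -/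

import Mathlib

namespace SimplePerm

/-! A permutation of length `n` is an element of `Equiv.Perm (Fin n)`; positions and values are
numbered from `0`, so the position (or value) written `j` in one-line notation is `j - 1` here. -/

/-- An interval: a contiguous set of positions whose set of values is also contiguous. -/
def IsInterval {n : ℕ} (π : Equiv.Perm (Fin n)) (I : Set (Fin n)) : Prop :=
  I.OrdConnected ∧ (π '' I).OrdConnected

/-- A permutation is simple if its only intervals have length `0`, `1` or `n`. -/
def IsSimple {n : ℕ} (π : Equiv.Perm (Fin n)) : Prop :=
  ∀ I : Set (Fin n), IsInterval π I → I.ncard = 0 ∨ I.ncard = 1 ∨ I.ncard = n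

/-- `π` contains `σ`: some subsequence of `π` is order isomorphic to `σ`. -/
def Contains {n m : ℕ} (π : Equiv.Perm (Fin n)) (σ : Equiv.Perm (Fin m)) : Prop :=
  ∃ f : Fin m → Fin n, StrictMono f ∧ ∀ i j, σ i < σ j ↔ π (f i) < π (f j)

/-! ### Symmetries -/

/-- The reverse `π(n) ⋯ π(1)` of a permutation. -/
def reverse {n : ℕ} (π : Equiv.Perm (Fin n)) : Equiv.Perm (Fin n) :=
  π * Fin.revPerm

/-- `τ` is one of the (at most eight) images of `σ` under the symmetries of the square, acting on
plots: `Fin.revPerm * σ` is the complement, `σ * Fin.revPerm` the reverse, `σ⁻¹` the inverse. -/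
def IsSymmetryOf {n : ℕ} (τ σ : Equiv.Perm (Fin n)) : Prop :=
  ∃ a b : Equiv.Perm (Fin n), (a = 1 ∨ a = Fin.revPerm) ∧ (b = 1 ∨ b = Fin.revPerm) ∧
    (τ = a * σ * b ∨ τ = a * σ⁻¹ * b)

/-! ### Alternations -/

/-- The positions of the odd entries (values numbered from `1`). -/
def oddSide {n : ℕ} (σ : Equiv.Perm (Fin n)) : Set (Fin n) := {i | Odd ((σ i : ℕ) + 1)}

/-- The positions of the even entries (values numbered from `1`). -/
def evenSide {n : ℕ} (σ : Equiv.Perm (Fin n)) : Set (Fin n) := {i | Even ((σ i : ℕ) + 1)}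

/-- Every odd entry lies to the left of every even entry. -/
def OddLeftOfEven {n : ℕ} (σ : Equiv.Perm (Fin n)) : Prop :=
  ∀ i ∈ oddSide σ, ∀ j ∈ evenSide σ, i < j

/-- A horizontal alternation: every odd entry lies to the left of every even entry, or the
reverse of such a permutation. -/
def IsHorizontalAlternation {n : ℕ} (σ : Equiv.Perm (Fin n)) : Prop :=
  OddLeftOfEven σ ∨ ∃ τ : Equiv.Perm (Fin n), OddLeftOfEven τ ∧ σ = reverse τ

/-- A horizontal alternation whose two sides are both increasing or both decreasing. -/
def IsHorizontalParallelAlternation {n : ℕ} (σ : Equiv.Perm (Fin n)) : Prop :=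
  IsHorizontalAlternation σ ∧
    ((StrictMonoOn σ (oddSide σ) ∧ StrictMonoOn σ (evenSide σ)) ∨
      (StrictAntiOn σ (oddSide σ) ∧ StrictAntiOn σ (evenSide σ)))

/-- A parallel alternation is a horizontal one or the inverse of a horizontal one (a vertical
one). -/
def IsParallelAlternation {n : ℕ} (σ : Equiv.Perm (Fin n)) : Prop :=
  IsHorizontalParallelAlternation σ ∨ IsHorizontalParallelAlternation σ⁻¹

/-! ### Wedge simple permutations -/

/-- The entry at position `i` (`1 ≤ i ≤ 2m`) of the word
`(m+1)(m-1)(m+2)(m-2) ⋯ (2m-1) 1 (2m) m`. -/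
def wedgeWord₁ (m i : ℕ) : ℕ :=
  if i = 2 * m then m else if Odd i then m + (i + 1) / 2 else m - i / 2

/-- The entry at position `i` (`1 ≤ i ≤ 2m`) of the word
`m (2m) (m-1)(m+1)(m-2)(m+2) ⋯ 1 (2m-1)`. -/
def wedgeWord₂ (m i : ℕ) : ℕ :=
  if i = 2 then 2 * m else if Odd i then m - (i - 1) / 2 else m + i / 2 - 1

/-- The type 1 wedge simple permutation of length `2m`, in its basic orientation. -/
def IsWedgeType₁ {m : ℕ} (σ : Equiv.Perm (Fin (2 * m))) : Prop :=
  ∀ i, (σ i : ℕ) + 1 = wedgeWord₁ m ((i : ℕ) + 1)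

/-- The type 2 wedge simple permutation of length `2m`, in its basic orientation. -/
def IsWedgeType₂ {m : ℕ} (σ : Equiv.Perm (Fin (2 * m))) : Prop :=
  ∀ i, (σ i : ℕ) + 1 = wedgeWord₂ m ((i : ℕ) + 1)

/-- A wedge simple permutation of length `2m`: type 1 or type 2, in any orientation. -/
def IsWedgeSimple {m : ℕ} (τ : Equiv.Perm (Fin (2 * m))) : Prop :=
  ∃ σ : Equiv.Perm (Fin (2 * m)), (IsWedgeType₁ σ ∨ IsWedgeType₂ σ) ∧ IsSymmetryOf τ σ

/-! ### Pin sequences -/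

/-- The plot of a permutation. -/
def plot {n : ℕ} (π : Equiv.Perm (Fin n)) : Set (Fin n × Fin n) :=
  Set.range fun i => (i, π i)

/-- The first coordinate of `q` lies in the range of the first coordinates of `S`. -/
def AmongFst {n : ℕ} (S : Set (Fin n × Fin n)) (q : Fin n × Fin n) : Prop :=
  ∃ a ∈ S, ∃ b ∈ S, a.1 ≤ q.1 ∧ q.1 ≤ b.1

/-- The second coordinate of `q` lies in the range of the second coordinates of `S`. -/
def AmongSnd {n : ℕ} (S : Set (Fin n × Fin n)) (q : Fin n × Fin n) : Prop :=
  ∃ a ∈ S, ∃ b ∈ S, a.2 ≤ q.2 ∧ q.2 ≤ b.2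

/-- The smallest axes-parallel rectangle containing `S`. -/
def rect {n : ℕ} (S : Set (Fin n × Fin n)) : Set (Fin n × Fin n) :=
  {q | AmongFst S q ∧ AmongSnd S q}

/-- A pin for `S`: a point outside `rect S` lying horizontally or vertically amongst `S`. -/
def IsPin {n : ℕ} (S : Set (Fin n × Fin n)) (q : Fin n × Fin n) : Prop :=
  q ∉ rect S ∧ (AmongFst S q ∨ AmongSnd S q)

/-- The four directions of a pin. -/
inductive Direction
  | up
  | down
  | left
  | right

/-- `q` lies beyond the set `R` in direction `d`. -/
def LiesBeyond {n : ℕ} (d : Direction) (R : Set (Fin n × Fin n)) (q : Fin n × Fin n) : Prop :=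
  match d with
  | .up => ∀ a ∈ R, a.2 < q.2
  | .down => ∀ a ∈ R, q.2 < a.2
  | .left => ∀ a ∈ R, q.1 < a.1
  | .right => ∀ a ∈ R, a.1 < q.1

/-- `q` is a pin for `S` with direction `d`. -/
def IsPinInDirection {n : ℕ} (d : Direction) (S : Set (Fin n × Fin n)) (q : Fin n × Fin n) :
    Prop :=
  IsPin S q ∧ LiesBeyond d (rect S) q

/-- `p` is at least as far as `q` in direction `d`. -/
def AtLeastAsFar {n : ℕ} (d : Direction) (p q : Fin n × Fin n) : Prop :=
  match d with
  | .up => q.2 ≤ p.2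
  | .down => p.2 ≤ q.2
  | .left => p.1 ≤ q.1
  | .right => q.1 ≤ p.1

/-- `q` lies horizontally or vertically between the point `p` and the set `R`. -/
def Separates {n : ℕ} (q p : Fin n × Fin n) (R : Set (Fin n × Fin n)) : Prop :=
  (∀ a ∈ R, a.1 < q.1 ∧ q.1 < p.1) ∨ (∀ a ∈ R, p.1 < q.1 ∧ q.1 < a.1) ∨
    (∀ a ∈ R, a.2 < q.2 ∧ q.2 < p.2) ∨ (∀ a ∈ R, p.2 < q.2 ∧ q.2 < a.2)

/-- The set of points of the sequence `p` that come before its `i`-th term. -/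
def before {n m : ℕ} (p : Fin m → Fin n × Fin n) (i : Fin m) : Set (Fin n × Fin n) :=
  p '' Set.Iio i

/-- `p` is a pin sequence of length `m` among the points of the plot of `π`: distinct points, each
of them from the third on being a pin for those before it. -/
def IsPinSequence {n m : ℕ} (π : Equiv.Perm (Fin n)) (p : Fin m → Fin n × Fin n) : Prop :=
  (∀ i, p i ∈ plot π) ∧ Function.Injective p ∧ ∀ i : Fin m, 2 ≤ (i : ℕ) → IsPin (before p i) (p i)

/-- Maximality: each pin is furthest among all pins of the plot of `π` for the same points with the
same direction. -/
def MaximalityCondition {n m : ℕ} (π : Equiv.Perm (Fin n)) (p : Fin m → Fin n × Fin n) : Prop :=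
  ∀ i : Fin m, 2 ≤ (i : ℕ) → ∀ d : Direction, IsPinInDirection d (before p i) (p i) →
    ∀ q ∈ plot π, IsPinInDirection d (before p i) q → AtLeastAsFar d (p i) q

/-- Separation: from the third point on, each term separates its predecessor from the rectangle
of the points before that predecessor. -/
def SeparationCondition {n m : ℕ} (p : Fin m → Fin n × Fin n) : Prop :=
  ∀ i j : Fin m, 1 ≤ (i : ℕ) → (j : ℕ) = (i : ℕ) + 1 → Separates (p j) (p i) (rect (before p i))

/-- `p` is a proper pin sequence of length `m` of `π`. -/
def IsProperPinSequence {n m : ℕ} (π : Equiv.Perm (Fin n)) (p : Fin m → Fin n × Fin n) : Prop :=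
  IsPinSequence π p ∧ MaximalityCondition π p ∧ SeparationCondition p

end SimplePerm

namespace SimplePerm

/-! ### Frames: the eight ways of reading the plot -/

/-! Suppose that every proper pin sequence has fewer than 2k points. A set of at least two entries
without pins spans an interval, so in a simple permutation furthest pins can be added to any two
entries until every extreme entry is reached. Dropping superfluous pins leaves a proper pin sequence
ending at a prescribed extreme entry (`exists_isProperPinList`). Start one at each pair of adjacent
positions and aim all of them at the rightmost entry. They form a tree of depth less than 2k, and n
is so large that some entry x is the next pin after at least 256k^8 different entries y
(`exists_many_predecessors`).

Up to symmetry, for 32k^8 of these, x is a right pin separating y, above, from the earlier points,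
below. Each y has a partner below x beside it: the adjacent starting entry, or an earlier point on
one side of y, where y is the highest entry over that stretch. Halving for the kind of partner and
applying Erdős–Szekeres to the y's, then to the partners, gives sizes 16k^8, 4k^4, 2k^2
(`exists_of_convergence`, `exists_of_partners`). The result alternates above and below x,
monotonically on each side.

If both sides have the same monotonicity, this is a parallel alternation. If they diverge towards x,
adding x gives a wedge simple permutation of type 1. If they converge towards x, a proper pin
sequence started at the apex must reach the far open end in fewer than 2k points, so one pin jumps
over k levels. It leaves through the open end (type 1), or above or below the wedge (type 2); this
is `exists_wedgeSimple_of_apex`. -/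

/-- A pair of coordinates on the entries of `π` that reads its plot up to a symmetry of the
square. -/
inductive IsFrame {n : ℕ} (π : Equiv.Perm (Fin n)) : (Fin n → ℤ) → (Fin n → ℤ) → Prop
  | base : IsFrame π (fun i => ((i : ℕ) : ℤ)) (fun i => ((π i : ℕ) : ℤ))
  | swap {u v : Fin n → ℤ} : IsFrame π u v → IsFrame π v u
  | neg {u v : Fin n → ℤ} : IsFrame π u v → IsFrame π (fun i => -u i) v

/-- The position (`true`) or the value (`false`) of an entry. -/
def coord {n : ℕ} (π : Equiv.Perm (Fin n)) (b : Bool) (i : Fin n) : ℤ :=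
  if b then ((i : ℕ) : ℤ) else ((π i : ℕ) : ℤ)

/-- A coordinate with its sign. -/
def signed {n : ℕ} (s : Bool) (f : Fin n → ℤ) (i : Fin n) : ℤ :=
  if s then f i else -f i

/-- The first coordinate of the frame with a given code. -/
def frameFst {n : ℕ} (π : Equiv.Perm (Fin n)) (c : Bool × Bool × Bool) : Fin n → ℤ :=
  signed c.2.1 (coord π c.1)

/-- The second coordinate of the frame with a given code. -/
def frameSnd {n : ℕ} (π : Equiv.Perm (Fin n)) (c : Bool × Bool × Bool) : Fin n → ℤ :=
  signed c.2.2 (coord π (!c.1))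

section Frames

variable {n : ℕ} {π : Equiv.Perm (Fin n)} {u v : Fin n → ℤ}

theorem neg_signed (s : Bool) (f : Fin n → ℤ) :
    (fun i => -signed s f i) = signed (!s) f := by
  funext i
  cases s <;> simp [signed]

theorem IsFrame.neg_snd (h : IsFrame π u v) : IsFrame π u (fun i => -v i) :=
  h.swap.neg.swap

theorem IsFrame.exists_code (h : IsFrame π u v) :
    ∃ c, u = frameFst π c ∧ v = frameSnd π c := by
  induction h with
  | base => exact ⟨(true, true, true), rfl, rfl⟩
  | swap _ ih =>
    obtain ⟨⟨b, s, t⟩, rfl, rfl⟩ := ih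
    exact ⟨(!b, t, s), rfl, by simp [frameFst, frameSnd]⟩
  | neg _ ih =>
    obtain ⟨⟨b, s, t⟩, rfl, rfl⟩ := ih
    exact ⟨(b, !s, t), by simp only [frameFst, neg_signed], rfl⟩

theorem isFrame_code (π : Equiv.Perm (Fin n)) (c : Bool × Bool × Bool) :
    IsFrame π (frameFst π c) (frameSnd π c) := by
  obtain ⟨b, s, t⟩ := c
  have h1 : IsFrame π (frameFst π (true, true, true)) (frameSnd π (true, true, true)) :=
    IsFrame.base
  have h2 : ∀ b, IsFrame π (frameFst π (b, true, true)) (frameSnd π (b, true, true)) := by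
    intro b
    cases b
    · exact h1.swap
    · exact h1
  have h3 : ∀ b s, IsFrame π (frameFst π (b, s, true)) (frameSnd π (b, s, true)) := by
    intro b s
    cases s
    · exact (h2 b).neg
    · exact h2 b
  cases t
  · exact (h3 b s).neg_snd
  · exact h3 b s

theorem coord_injective (π : Equiv.Perm (Fin n)) (b : Bool) : Function.Injective (coord π b) := by
  intro i j h
  cases b
  · exact π.injective (Fin.ext (by simpa [coord] using h))
  · exact Fin.ext (by simpa [coord] using h)

theorem signed_injective {f : Fin n → ℤ} (hf : Function.Injective f) (s : Bool) :
    Function.Injective (signed s f) := by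
  intro i j h
  cases s <;> simp only [signed, if_true, if_false, neg_inj, Bool.false_eq_true] at h <;> exact hf h

theorem IsFrame.injective_fst (h : IsFrame π u v) : Function.Injective u := by
  obtain ⟨c, rfl, -⟩ := h.exists_code
  exact signed_injective (coord_injective π _) _

theorem IsFrame.injective_snd (h : IsFrame π u v) : Function.Injective v :=
  h.swap.injective_fst

/-- Pins of one list may be read in different frames. Up to signs there are two cases, and the
position of the pin relative to the list excludes most of them. -/
theorem IsFrame.comparable {u' v' : Fin n → ℤ} (h : IsFrame π u v) (h' : IsFrame π u' v') :
    ((u' = u ∨ u' = fun i => -u i) ∧ (v' = v ∨ v' = fun i => -v i)) ∨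
      ((u' = v ∨ u' = fun i => -v i) ∧ (v' = u ∨ v' = fun i => -u i)) := by
  obtain ⟨⟨b, s, t⟩, rfl, rfl⟩ := h.exists_code
  obtain ⟨⟨b', s', t'⟩, rfl, rfl⟩ := h'.exists_code
  have key : ∀ (s s' : Bool) (f : Fin n → ℤ),
      signed s' f = signed s f ∨ signed s' f = signed (!s) f := by
    intro s s' f
    cases s <;> cases s' <;> simp
  simp only [frameFst, frameSnd, neg_signed]
  rcases Bool.eq_or_eq_not b' b with rfl | rfl
  · exact Or.inl ⟨key _ _ _, key _ _ _⟩
  · refine Or.inr ⟨key _ _ _, ?_⟩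
    rw [Bool.not_not]
    exact key _ _ _

end Frames

/-! ### Patterns read in a frame -/

section Patterns

variable {n m : ℕ} {π : Equiv.Perm (Fin n)} {u v : Fin n → ℤ}

theorem IsSymmetryOf.of_inv {τ σ : Equiv.Perm (Fin m)} (h : IsSymmetryOf τ σ⁻¹) :
    IsSymmetryOf τ σ := by
  obtain ⟨a, b, ha, hb, h | h⟩ := h
  · exact ⟨a, b, ha, hb, Or.inr h⟩
  · exact ⟨a, b, ha, hb, Or.inl (by simpa using h)⟩

theorem revPerm_mul_self : (Fin.revPerm : Equiv.Perm (Fin m)) * Fin.revPerm = 1 := by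
  ext i
  simp

theorem revPerm_inv : (Fin.revPerm : Equiv.Perm (Fin m))⁻¹ = Fin.revPerm :=
  inv_eq_of_mul_eq_one_left revPerm_mul_self

theorem IsSymmetryOf.of_mul_revPerm {τ σ : Equiv.Perm (Fin m)}
    (h : IsSymmetryOf τ (σ * Fin.revPerm)) : IsSymmetryOf τ σ := by
  have key : ∀ a : Equiv.Perm (Fin m), a = 1 ∨ a = Fin.revPerm →
      (a * Fin.revPerm = 1 ∨ a * Fin.revPerm = Fin.revPerm) ∧
        (Fin.revPerm * a = 1 ∨ Fin.revPerm * a = Fin.revPerm) := by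
    rintro a (rfl | rfl)
    · simp
    · simp [revPerm_mul_self]
  obtain ⟨a, b, ha, hb, h | h⟩ := h
  · exact ⟨a, Fin.revPerm * b, ha, (key b hb).2, Or.inl (by rw [h]; simp only [mul_assoc])⟩
  · refine ⟨a * Fin.revPerm, b, (key a ha).1, hb, Or.inr ?_⟩
    rw [h, mul_inv_rev, revPerm_inv]
    simp only [mul_assoc]

/-- A pattern seen in a frame gives a symmetry of it contained in the permutation. -/
theorem IsFrame.exists_contains (h : IsFrame π u v) :
    ∀ (σ : Equiv.Perm (Fin m)) (g : Fin m → Fin n), StrictMono (u ∘ g) →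
      (∀ i j, σ i < σ j ↔ v (g i) < v (g j)) → ∃ τ, IsSymmetryOf τ σ ∧ Contains π τ := by
  induction h with
  | base =>
    intro σ g hg hσ
    refine ⟨σ, ⟨1, 1, Or.inl rfl, Or.inl rfl, Or.inl (by simp)⟩, g, ?_, ?_⟩
    · intro i j hij
      have := hg hij
      simpa using this
    · intro i j
      rw [hσ]
      simp
  | @swap u v _ ih =>
    intro σ g hg hσ
    -- Exchanging the coordinates inverts the pattern: the same points are now listed by value.
    obtain ⟨τ, h1, h2⟩ := ih σ⁻¹ (g ∘ ⇑(σ⁻¹)) (by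
      intro i j hij
      have := (hσ (σ⁻¹ i) (σ⁻¹ j)).1 (by simpa using hij)
      simpa using this) (by
      intro i j
      exact (hg.lt_iff_lt (a := σ⁻¹ i) (b := σ⁻¹ j)).symm)
    exact ⟨τ, h1.of_inv, h2⟩
  | @neg u v _ ih =>
    intro σ g hg hσ
    obtain ⟨τ, h1, h2⟩ := ih (σ * Fin.revPerm) (g ∘ Fin.rev) (by
      intro i j hij
      have := hg (Fin.rev_lt_rev.2 hij)
      simpa using this) (by
      intro i j
      simpa using hσ i.rev j.rev)
    exact ⟨τ, h1.of_mul_revPerm, h2⟩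

/-- The permutation of ranks of an injective function. -/
theorem exists_ranks {w : Fin m → ℤ} (hw : Function.Injective w) :
    ∃ ρ : Equiv.Perm (Fin m), ∀ i j, ρ i < ρ j ↔ w i < w j := by
  refine ⟨(Tuple.sort w)⁻¹, fun i j => ?_⟩
  have hs : StrictMono (w ∘ Tuple.sort w) :=
    (Tuple.monotone_sort w).strictMono_of_injective (hw.comp (Tuple.sort w).injective)
  have := hs.lt_iff_lt (a := (Tuple.sort w)⁻¹ i) (b := (Tuple.sort w)⁻¹ j)
  simpa using this.symm

/-- A word with distinct letters `1, …, m` is the word of a permutation. -/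
theorem exists_perm_of_word (word : ℕ → ℕ) (h1 : ∀ i < m, 1 ≤ word (i + 1) ∧ word (i + 1) ≤ m)
    (h2 : ∀ i < m, ∀ j < m, word (i + 1) = word (j + 1) → i = j) :
    ∃ σ : Equiv.Perm (Fin m), ∀ i, (σ i : ℕ) + 1 = word ((i : ℕ) + 1) := by
  let f : Fin m → Fin m := fun i => ⟨word (i + 1) - 1, by have := h1 i i.2; omega⟩
  have hf : Function.Injective f := by
    intro i j hij
    have h3 := h1 i i.2
    have h4 := h1 j j.2
    have h5 : word (i + 1) - 1 = word (j + 1) - 1 := by simpa [f] using hij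
    exact Fin.ext (h2 i i.2 j j.2 (by omega))
  refine ⟨Equiv.ofBijective f (Finite.injective_iff_bijective.1 hf), fun i => ?_⟩
  have h3 := h1 i i.2
  simp only [Equiv.ofBijective_apply, f]
  omega

/-- The pattern of a word, read in a frame. -/
theorem IsFrame.exists_contains_word (h : IsFrame π u v) (word : ℕ → ℕ)
    (h1 : ∀ i < m, 1 ≤ word (i + 1) ∧ word (i + 1) ≤ m)
    (g : ℕ → Fin n) (hg : ∀ i, i + 1 < m → u (g i) < u (g (i + 1)))
    (hv : ∀ i < m, ∀ j < m, word (i + 1) < word (j + 1) → v (g i) < v (g j))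
    (hw : ∀ i < m, ∀ j < m, word (i + 1) = word (j + 1) → i = j) :
    ∃ σ τ : Equiv.Perm (Fin m), (∀ i, (σ i : ℕ) + 1 = word ((i : ℕ) + 1)) ∧
      IsSymmetryOf τ σ ∧ Contains π τ := by
  obtain ⟨σ, hσ⟩ := exists_perm_of_word word h1 hw
  have hmono : ∀ d i, i + d + 1 < m → u (g i) < u (g (i + d + 1)) := by
    intro d
    induction d with
    | zero => intro i hi; exact hg i hi
    | succ d ih =>
      intro i hi
      exact (ih i (by omega)).trans (hg (i + d + 1) (by omega))
  have hlt : ∀ i j : Fin m, σ i < σ j ↔ word ((i : ℕ) + 1) < word ((j : ℕ) + 1) := by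
    intro i j
    rw [← hσ, ← hσ, Fin.lt_def]
    omega
  obtain ⟨τ, h3, h4⟩ := h.exists_contains σ (fun i => g i) (by
    intro i j hij
    have h3 := Fin.lt_def.1 hij
    obtain ⟨d, hd⟩ := Nat.exists_eq_add_of_lt h3
    have := hmono d i (by omega)
    simpa [hd] using this) (by
    intro i j
    rw [hlt]
    refine ⟨hv i i.2 j j.2, fun h5 => ?_⟩
    by_contra h6
    rcases lt_or_eq_of_le (not_lt.1 h6) with h7 | h7
    · exact absurd (hv j j.2 i i.2 h7) (not_lt.2 h5.le)
    · have := hw j j.2 i i.2 h7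
      rw [this] at h5
      exact lt_irrefl _ h5)
  exact ⟨σ, τ, hσ, h3, h4⟩

end Patterns

/-! ### Parallel alternations -/

/-- The entries at even positions all lie on one side of those at odd positions, and the two
classes are both increasing or both decreasing: the inverse of a horizontal parallel
alternation. -/
def IsParallelChain {m : ℕ} (ρ : Equiv.Perm (Fin m)) : Prop :=
  ((∀ i j : Fin m, Even (i : ℕ) → Odd (j : ℕ) → ρ i < ρ j) ∨
      (∀ i j : Fin m, Even (i : ℕ) → Odd (j : ℕ) → ρ j < ρ i)) ∧
    ((∀ i j : Fin m, (Even (i : ℕ) ↔ Even (j : ℕ)) → i < j → ρ i < ρ j) ∨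
      (∀ i j : Fin m, (Even (i : ℕ) ↔ Even (j : ℕ)) → i < j → ρ j < ρ i))

section Parallel

variable {m k : ℕ}

/-- Positions of `ρ` are the values of `ρ⁻¹`. Positions count from 0 and the parity of entries from
1, so even positions become odd entries. -/
theorem IsParallelChain.horizontal {ρ : Equiv.Perm (Fin m)} (h : IsParallelChain ρ) :
    IsHorizontalParallelAlternation ρ⁻¹ := by
  obtain ⟨h1, h2⟩ := h
  have odd_iff : ∀ p : Fin m, p ∈ oddSide ρ⁻¹ ↔ Even ((ρ⁻¹ p : Fin m) : ℕ) := by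
    intro p
    simp [oddSide, Nat.odd_add_one]
  have even_iff : ∀ p : Fin m, p ∈ evenSide ρ⁻¹ ↔ Odd ((ρ⁻¹ p : Fin m) : ℕ) := by
    intro p
    simp [evenSide, Nat.even_add_one]
  have hinv : ∀ p, ρ (ρ⁻¹ p) = p := fun p => by simp
  constructor
  · rcases h1 with h1 | h1
    · left
      intro p hp q hq
      have := h1 _ _ ((odd_iff p).1 hp) ((even_iff q).1 hq)
      rwa [hinv, hinv] at this
    · right
      refine ⟨reverse ρ⁻¹, ?_, ?_⟩
      · intro p hp q hq
        have hp' : p.rev ∈ oddSide ρ⁻¹ := by simpa [oddSide, reverse] using hp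
        have hq' : q.rev ∈ evenSide ρ⁻¹ := by simpa [evenSide, reverse] using hq
        have := h1 _ _ ((odd_iff _).1 hp') ((even_iff _).1 hq')
        rw [hinv, hinv] at this
        exact Fin.rev_lt_rev.1 this
      · simp only [reverse, mul_assoc, revPerm_mul_self, mul_one]
  · have parity : ∀ p q : Fin m, (p ∈ oddSide ρ⁻¹ ∧ q ∈ oddSide ρ⁻¹) ∨
        (p ∈ evenSide ρ⁻¹ ∧ q ∈ evenSide ρ⁻¹) →
        (Even ((ρ⁻¹ p : Fin m) : ℕ) ↔ Even ((ρ⁻¹ q : Fin m) : ℕ)) := by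
      rintro p q (⟨hp, hq⟩ | ⟨hp, hq⟩)
      · exact iff_of_true ((odd_iff p).1 hp) ((odd_iff q).1 hq)
      · exact iff_of_false (Nat.not_even_iff_odd.2 ((even_iff p).1 hp))
          (Nat.not_even_iff_odd.2 ((even_iff q).1 hq))
    rcases h2 with h2 | h2
    · have key : ∀ p q : Fin m, (p ∈ oddSide ρ⁻¹ ∧ q ∈ oddSide ρ⁻¹) ∨
          (p ∈ evenSide ρ⁻¹ ∧ q ∈ evenSide ρ⁻¹) → p < q → ρ⁻¹ p < ρ⁻¹ q := by
        intro p q hpq hlt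
        by_contra hcon
        rcases lt_or_eq_of_le (not_lt.1 hcon) with h3 | h3
        · have := h2 _ _ (parity p q hpq).symm h3
          rw [hinv, hinv] at this
          exact lt_asymm this hlt
        · exact hlt.ne' (ρ⁻¹.injective h3)
      exact Or.inl ⟨fun p hp q hq h => key p q (Or.inl ⟨hp, hq⟩) h,
        fun p hp q hq h => key p q (Or.inr ⟨hp, hq⟩) h⟩
    · have key : ∀ p q : Fin m, (p ∈ oddSide ρ⁻¹ ∧ q ∈ oddSide ρ⁻¹) ∨
          (p ∈ evenSide ρ⁻¹ ∧ q ∈ evenSide ρ⁻¹) → p < q → ρ⁻¹ q < ρ⁻¹ p := by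
        intro p q hpq hlt
        by_contra hcon
        rcases lt_or_eq_of_le (not_lt.1 hcon) with h3 | h3
        · have := h2 _ _ (parity p q hpq) h3
          rw [hinv, hinv] at this
          exact lt_asymm this hlt
        · exact hlt.ne (ρ⁻¹.injective h3)
      exact Or.inr ⟨fun p hp q hq h => key p q (Or.inl ⟨hp, hq⟩) h,
        fun p hp q hq h => key p q (Or.inr ⟨hp, hq⟩) h⟩

theorem IsParallelChain.revPerm_mul {ρ : Equiv.Perm (Fin m)} (h : IsParallelChain ρ) :
    IsParallelChain (Fin.revPerm * ρ) := by
  simpa [IsParallelChain, or_comm] using h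

theorem even_rev_iff (i : Fin (2 * k)) : Even ((i.rev : Fin (2 * k)) : ℕ) ↔ ¬Even (i : ℕ) := by
  rw [Fin.val_rev, Nat.even_iff, Nat.even_iff]
  omega

/-- Since the length is even, reversal exchanges the two parity classes of positions. -/
theorem IsParallelChain.mul_revPerm {ρ : Equiv.Perm (Fin (2 * k))} (h : IsParallelChain ρ) :
    IsParallelChain (ρ * Fin.revPerm) := by
  obtain ⟨h1, h2⟩ := h
  constructor
  · refine h1.symm.imp ?_ ?_ <;>
    · intro h1 i j hi hj
      exact h1 j.rev i.rev ((even_rev_iff j).2 (Nat.not_even_iff_odd.2 hj))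
        (Nat.not_even_iff_odd.1 fun h => (even_rev_iff i).1 h hi)
  · refine h2.symm.imp ?_ ?_ <;>
    · intro h2 i j hij hlt
      exact h2 j.rev i.rev (by rw [even_rev_iff, even_rev_iff, hij]) (Fin.rev_lt_rev.2 hlt)

theorem IsParallelChain.isParallelAlternation {ρ τ : Equiv.Perm (Fin (2 * k))}
    (h : IsParallelChain ρ) (hτ : IsSymmetryOf τ ρ) : IsParallelAlternation τ := by
  have key : ∀ a b : Equiv.Perm (Fin (2 * k)), (a = 1 ∨ a = Fin.revPerm) →
      (b = 1 ∨ b = Fin.revPerm) → IsParallelChain (a * ρ * b) := by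
    rintro a b (rfl | rfl) (rfl | rfl)
    · simpa using h
    · simpa using h.mul_revPerm
    · simpa using h.revPerm_mul
    · exact h.revPerm_mul.mul_revPerm
  have inv_mem : ∀ a : Equiv.Perm (Fin (2 * k)), (a = 1 ∨ a = Fin.revPerm) →
      (a⁻¹ = 1 ∨ a⁻¹ = Fin.revPerm) := by
    rintro a (rfl | rfl)
    · simp
    · exact Or.inr revPerm_inv
  obtain ⟨a, b, ha, hb, h | h⟩ := hτ
  · right
    rw [h]
    exact (key a b ha hb).horizontal
  · left
    have := (key b⁻¹ a⁻¹ (inv_mem b hb) (inv_mem a ha)).horizontal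
    have e : (b⁻¹ * ρ * a⁻¹)⁻¹ = τ := by rw [h]; group
    rwa [e] at this

/-- An alternating chain of points in a frame gives a parallel alternation. -/
theorem IsFrame.exists_parallel {n : ℕ} {π : Equiv.Perm (Fin n)} {u v : Fin n → ℤ}
    (h : IsFrame π u v) (a b : ℕ → Fin n)
    (hab : ∀ i < k, u (a i) < u (b i)) (hba : ∀ i, i + 1 < k → u (b i) < u (a (i + 1)))
    (hsep : ∀ i < k, ∀ j < k, v (b i) < v (a j))
    (hmono : (∀ i j, i < j → j < k → v (a i) < v (a j) ∧ v (b i) < v (b j)) ∨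
      (∀ i j, i < j → j < k → v (a j) < v (a i) ∧ v (b j) < v (b i))) :
    ∃ σ : Equiv.Perm (Fin (2 * k)), IsParallelAlternation σ ∧ Contains π σ := by
  let g : ℕ → Fin n := fun i => if Even i then a (i / 2) else b (i / 2)
  have ge : ∀ i, Even i → g i = a (i / 2) := fun i hi => if_pos hi
  have go : ∀ i, ¬Even i → g i = b (i / 2) := fun i hi => if_neg hi
  have hstep : ∀ i, i + 1 < 2 * k → u (g i) < u (g (i + 1)) := by
    intro i hi
    by_cases hp : Even i
    · rw [ge i hp, go (i + 1) (by simpa [Nat.even_add_one] using hp)]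
      rw [Nat.even_iff] at hp
      have e : (i + 1) / 2 = i / 2 := by omega
      rw [e]
      exact hab _ (by omega)
    · rw [go i hp, ge (i + 1) (by simpa [Nat.even_add_one] using hp)]
      rw [Nat.even_iff] at hp
      have e : (i + 1) / 2 = i / 2 + 1 := by omega
      rw [e]
      exact hba _ (by omega)
  have hmonog : StrictMono (u ∘ fun i : Fin (2 * k) => g i) := by
    intro i j hij
    have hall : ∀ d, (i : ℕ) + d + 1 < 2 * k → u (g i) < u (g ((i : ℕ) + d + 1)) := by
      intro d
      induction d with
      | zero => exact hstep i
      | succ d ih => exact fun hd => (ih (by omega)).trans (hstep _ hd)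
    obtain ⟨d, hd⟩ := Nat.exists_eq_add_of_lt (Fin.lt_def.1 hij)
    have := hall d (by omega)
    simpa [hd] using this
  have hinj : Function.Injective fun i : Fin (2 * k) => v (g i) := by
    intro i j hij
    exact hmonog.injective (by
      have := h.injective_snd hij
      simp [this])
  obtain ⟨ρ, hρ⟩ := exists_ranks hinj
  have hchain : IsParallelChain ρ := by
    constructor
    · right
      intro i j hi hj
      rw [hρ, ge i hi, go j (Nat.not_even_iff_odd.2 hj)]
      exact hsep _ (by omega) _ (by omega)
    · refine hmono.imp ?_ ?_ <;>
      · intro hmono i j hij hlt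
        have hlt' := Fin.lt_def.1 hlt
        rw [hρ]
        by_cases hp : Even (i : ℕ)
        · have hq := hij.1 hp
          rw [ge i hp, ge j hq]
          rw [Nat.even_iff] at hp hq
          exact (hmono _ _ (by omega) (by omega)).1
        · have hq : ¬Even (j : ℕ) := fun h => hp (hij.2 h)
          rw [go i hp, go j hq]
          rw [Nat.even_iff] at hp hq
          exact (hmono _ _ (by omega) (by omega)).2
  obtain ⟨τ, h1, h2⟩ := h.exists_contains ρ (fun i => g i) hmonog hρ
  exact ⟨τ, hchain.isParallelAlternation h1, h2⟩

end Parallel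

/-! ### Wedge simple permutations read in a frame -/

section Wedges

variable {n k : ℕ} {π : Equiv.Perm (Fin n)} {u v : Fin n → ℤ}

/-- A wedge opening to the right, with a point at its open end. -/
theorem IsFrame.exists_wedge₁ (h : IsFrame π u v) (hk : 1 ≤ k) (a b : ℕ → Fin n) (x : Fin n)
    (hab : ∀ i, i + 1 < k → u (a i) < u (b i)) (hba : ∀ i, i + 1 < k → u (b i) < u (a (i + 1)))
    (hax : u (a (k - 1)) < u x)
    (ha : ∀ i j, i < j → j < k → v (a i) < v (a j))
    (hb : ∀ i j, i < j → j + 1 < k → v (b j) < v (b i))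
    (hbx : ∀ i, i + 1 < k → v (b i) < v x) (hxa : ∀ i < k, v x < v (a i)) :
    ∃ σ : Equiv.Perm (Fin (2 * k)), IsWedgeSimple σ ∧ Contains π σ := by
  -- There are k upper points, k - 1 lower points, and x in the last place.
  let g : ℕ → Fin n := fun i => if i + 1 = 2 * k then x else if Even i then a (i / 2) else b (i / 2)
  have gx : ∀ i, i + 1 = 2 * k → g i = x := fun i hi => if_pos hi
  have ge : ∀ i, i + 1 ≠ 2 * k → Even i → g i = a (i / 2) := fun i h1 h2 => by simp [g, h1, h2]
  have go : ∀ i, i + 1 ≠ 2 * k → ¬Even i → g i = b (i / 2) := fun i h1 h2 => by simp [g, h1, h2]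
  have wx : ∀ i, i + 1 = 2 * k → wedgeWord₁ k (i + 1) = k := fun i hi => if_pos hi
  have we : ∀ i, i + 1 ≠ 2 * k → Even i → wedgeWord₁ k (i + 1) = k + i / 2 + 1 := by
    intro i h1 h2
    rw [wedgeWord₁, if_neg h1, if_pos h2.add_one]
    omega
  have wo : ∀ i, i + 1 ≠ 2 * k → ¬Even i → wedgeWord₁ k (i + 1) = k - (i / 2 + 1) := by
    intro i h1 h2
    rw [wedgeWord₁, if_neg h1, if_neg (by simpa [Nat.odd_add_one] using h2)]
    rw [Nat.even_iff] at h2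
    omega
  obtain ⟨σ, τ, h1, h2, h3⟩ := h.exists_contains_word (m := 2 * k) (wedgeWord₁ k)
    (by
      intro i hi
      by_cases hx : i + 1 = 2 * k
      · rw [wx i hx]; omega
      · by_cases hp : Even i
        · rw [we i hx hp]; omega
        · rw [wo i hx hp]; rw [Nat.even_iff] at hp; omega)
    g
    (by
      intro i hi
      by_cases hx : i + 1 + 1 = 2 * k
      · have hp : Even i := by rw [Nat.even_iff]; omega
        rw [gx _ hx, ge i (by omega) hp]
        have e : i / 2 = k - 1 := by omega
        rwa [e]
      · by_cases hp : Even i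
        · rw [ge i (by omega) hp, go (i + 1) hx (by simpa [Nat.even_add_one] using hp)]
          rw [Nat.even_iff] at hp
          have e : (i + 1) / 2 = i / 2 := by omega
          rw [e]
          exact hab _ (by omega)
        · rw [go i (by omega) hp, ge (i + 1) hx (by simpa [Nat.even_add_one] using hp)]
          rw [Nat.even_iff] at hp
          have e : (i + 1) / 2 = i / 2 + 1 := by omega
          rw [e]
          exact hba _ (by omega))
    (by
      intro i hi j hj hw
      have hbk : ∀ i < 2 * k, i + 1 ≠ 2 * k → ¬Even i → i / 2 + 1 < k := by
        intro i h1 h2 h3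
        rw [Nat.even_iff] at h3
        omega
      by_cases hxi : i + 1 = 2 * k
      · rw [wx i hxi] at hw
        by_cases hxj : j + 1 = 2 * k
        · rw [wx j hxj] at hw; omega
        · by_cases hpj : Even j
          · rw [gx i hxi, ge j hxj hpj]
            exact hxa _ (by omega)
          · rw [wo j hxj hpj] at hw; omega
      · by_cases hpi : Even i
        · rw [we i hxi hpi] at hw
          by_cases hxj : j + 1 = 2 * k
          · rw [wx j hxj] at hw; omega
          · by_cases hpj : Even j
            · rw [we j hxj hpj] at hw
              rw [ge i hxi hpi, ge j hxj hpj]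
              exact ha _ _ (by omega) (by omega)
            · rw [wo j hxj hpj] at hw; omega
        · have hik := hbk i hi hxi hpi
          rw [wo i hxi hpi] at hw
          rw [go i hxi hpi]
          by_cases hxj : j + 1 = 2 * k
          · rw [gx j hxj]
            exact hbx _ hik
          · by_cases hpj : Even j
            · rw [ge j hxj hpj]
              exact (hbx _ hik).trans (hxa _ (by omega))
            · have hjk := hbk j hj hxj hpj
              rw [wo j hxj hpj] at hw
              rw [go j hxj hpj]
              exact hb _ _ (by omega) hik)
    (by
      intro i hi j hj hw
      by_cases hxi : i + 1 = 2 * k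
      · rw [wx i hxi] at hw
        by_cases hxj : j + 1 = 2 * k
        · omega
        · by_cases hpj : Even j
          · rw [we j hxj hpj] at hw; omega
          · rw [wo j hxj hpj] at hw; omega
      · by_cases hpi : Even i
        · rw [we i hxi hpi] at hw
          by_cases hxj : j + 1 = 2 * k
          · rw [wx j hxj] at hw; omega
          · by_cases hpj : Even j
            · rw [we j hxj hpj] at hw
              rw [Nat.even_iff] at hpi hpj
              omega
            · rw [wo j hxj hpj] at hw; omega
        · rw [wo i hxi hpi] at hw
          by_cases hxj : j + 1 = 2 * k
          · rw [wx j hxj] at hw; omega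
          · by_cases hpj : Even j
            · rw [we j hxj hpj] at hw; omega
            · rw [wo j hxj hpj] at hw
              rw [Nat.even_iff] at hpi hpj
              omega)
  exact ⟨τ, ⟨σ, Or.inl h1, h2⟩, h3⟩

/-- A wedge opening to the right, with a point at its apex separated from it by a point above. -/
theorem IsFrame.exists_wedge₂ (h : IsFrame π u v) (hk : 2 ≤ k) (a b : ℕ → Fin n) (p q : Fin n)
    (hqp : u q < u p) (hpb : u p < u (b 0))
    (hba : ∀ i, i + 1 < k → u (b i) < u (a i))
    (hab : ∀ i, i + 2 < k → u (a i) < u (b (i + 1)))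
    (ha : ∀ i j, i < j → j + 1 < k → v (a i) < v (a j))
    (hb : ∀ i j, i < j → j + 1 < k → v (b j) < v (b i))
    (hbq : ∀ i, i + 1 < k → v (b i) < v q) (hqa : ∀ i, i + 1 < k → v q < v (a i))
    (hap : ∀ i, i + 1 < k → v (a i) < v p) :
    ∃ σ : Equiv.Perm (Fin (2 * k)), IsWedgeSimple σ ∧ Contains π σ := by
  -- The points q and p come first, followed by k - 1 points from each side.
  let g : ℕ → Fin n := fun i => if i = 0 then q else if i = 1 then p else
    if Even i then b (i / 2 - 1) else a (i / 2 - 1)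
  have g0 : g 0 = q := rfl
  have g1 : g 1 = p := rfl
  have ge : ∀ i, 2 ≤ i → Even i → g i = b (i / 2 - 1) := fun i h1 h2 => by
    have h3 : i ≠ 0 := by omega
    have h4 : i ≠ 1 := by omega
    simp [g, h3, h4, h2]
  have go : ∀ i, 2 ≤ i → ¬Even i → g i = a (i / 2 - 1) := fun i h1 h2 => by
    have h3 : i ≠ 0 := by omega
    have h4 : i ≠ 1 := by omega
    simp [g, h3, h4, h2]
  have w0 : wedgeWord₂ k (0 + 1) = k := by simp [wedgeWord₂]
  have w1 : wedgeWord₂ k (1 + 1) = 2 * k := by simp [wedgeWord₂]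
  have we : ∀ i, 2 ≤ i → Even i → wedgeWord₂ k (i + 1) = k - i / 2 := by
    intro i h1 h2
    rw [wedgeWord₂, if_neg (by omega), if_pos h2.add_one]
    simp
  have wo : ∀ i, 2 ≤ i → ¬Even i → wedgeWord₂ k (i + 1) = k + i / 2 := by
    intro i h1 h2
    rw [wedgeWord₂, if_neg (by omega), if_neg (by simpa [Nat.odd_add_one] using h2)]
    rw [Nat.even_iff] at h2
    omega
  have hsmall : ∀ i < 2 * k, 2 ≤ i → 1 ≤ i / 2 ∧ i / 2 - 1 + 1 < k := by omega
  have hcases : ∀ i, i = 0 ∨ i = 1 ∨ (2 ≤ i ∧ Even i) ∨ (2 ≤ i ∧ ¬Even i) := by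
    intro i
    by_cases hp : Even i <;> simp only [hp, not_true, not_false_iff, and_true, and_false] <;> omega
  obtain ⟨σ, τ, h1, h2, h3⟩ := h.exists_contains_word (m := 2 * k) (wedgeWord₂ k)
    (by
      intro i hi
      rcases hcases i with rfl | rfl | ⟨h2, hp⟩ | ⟨h2, hp⟩
      · rw [w0]; omega
      · rw [w1]; omega
      · rw [we i h2 hp]; omega
      · rw [wo i h2 hp]; omega)
    g
    (by
      intro i hi
      rcases hcases i with rfl | rfl | ⟨h2, hp⟩ | ⟨h2, hp⟩
      · exact hqp
      · exact hpb
      · rw [ge i h2 hp, go (i + 1) (by omega) (by simpa [Nat.even_add_one] using hp)]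
        rw [Nat.even_iff] at hp
        have e : (i + 1) / 2 - 1 = i / 2 - 1 := by omega
        rw [e]
        exact hba _ (by omega)
      · rw [go i h2 hp, ge (i + 1) (by omega) (by simpa [Nat.even_add_one] using hp)]
        rw [Nat.even_iff] at hp
        have e : (i + 1) / 2 - 1 = i / 2 - 1 + 1 := by omega
        rw [e]
        exact hab _ (by omega))
    (by
      intro i hi j hj hw
      rcases hcases i with rfl | rfl | ⟨h2, hp⟩ | ⟨h2, hp⟩
      · rw [w0] at hw
        rw [g0]
        rcases hcases j with rfl | rfl | ⟨h2', hp'⟩ | ⟨h2', hp'⟩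
        · rw [w0] at hw; omega
        · exact (hqa 0 (by omega)).trans (hap 0 (by omega))
        · rw [we j h2' hp'] at hw; omega
        · rw [go j h2' hp']
          exact hqa _ (hsmall j hj h2').2
      · rw [w1] at hw
        rcases hcases j with rfl | rfl | ⟨h2', hp'⟩ | ⟨h2', hp'⟩
        · rw [w0] at hw; omega
        · rw [w1] at hw; omega
        · rw [we j h2' hp'] at hw; omega
        · rw [wo j h2' hp'] at hw; omega
      · rw [we i h2 hp] at hw
        rw [ge i h2 hp]
        have hik := hsmall i hi h2
        rcases hcases j with rfl | rfl | ⟨h2', hp'⟩ | ⟨h2', hp'⟩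
        · exact hbq _ hik.2
        · exact ((hbq _ hik.2).trans (hqa _ hik.2)).trans (hap _ hik.2)
        · have hjk := hsmall j hj h2'
          rw [we j h2' hp'] at hw
          rw [ge j h2' hp']
          exact hb _ _ (by omega) hik.2
        · have hjk := hsmall j hj h2'
          rw [go j h2' hp']
          exact (hbq _ hik.2).trans (hqa _ hjk.2)
      · rw [wo i h2 hp] at hw
        rw [go i h2 hp]
        have hik := hsmall i hi h2
        rcases hcases j with rfl | rfl | ⟨h2', hp'⟩ | ⟨h2', hp'⟩
        · rw [w0] at hw; omega
        · exact hap _ hik.2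
        · rw [we j h2' hp'] at hw; omega
        · have hjk := hsmall j hj h2'
          rw [wo j h2' hp'] at hw
          rw [go j h2' hp']
          exact ha _ _ (by omega) hjk.2)
    (by
      intro i hi j hj hw
      have key : ∀ i < 2 * k, (i = 0 ∧ wedgeWord₂ k (i + 1) = k) ∨
          (i = 1 ∧ wedgeWord₂ k (i + 1) = 2 * k) ∨
          (2 ≤ i ∧ i % 2 = 0 ∧ wedgeWord₂ k (i + 1) = k - i / 2) ∨
          (2 ≤ i ∧ i % 2 = 1 ∧ wedgeWord₂ k (i + 1) = k + i / 2) := by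
        intro i hi
        rcases hcases i with rfl | rfl | ⟨h2, hp⟩ | ⟨h2, hp⟩
        · exact Or.inl ⟨rfl, w0⟩
        · exact Or.inr (Or.inl ⟨rfl, w1⟩)
        · exact Or.inr (Or.inr (Or.inl ⟨h2, Nat.even_iff.1 hp, we i h2 hp⟩))
        · exact Or.inr (Or.inr (Or.inr ⟨h2, Nat.not_even_iff.1 hp, wo i h2 hp⟩))
      have h4 := key i hi
      have h5 := key j hj
      rw [hw] at h4
      omega)
  exact ⟨τ, ⟨σ, Or.inr h1, h2⟩, h3⟩

end Wedges

/-! ### Pin sequences as lists, latest pin first -/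

/-- In the frame `u, v`, the entry `x` is the furthest right pin for `S`. -/
def IsRightMaxPin {n : ℕ} (u v : Fin n → ℤ) (S : List (Fin n)) (x : Fin n) : Prop :=
  (∃ a ∈ S, ∃ b ∈ S, v a < v x ∧ v x < v b) ∧ (∀ a ∈ S, u a < u x) ∧
    ∀ q, (∃ a ∈ S, ∃ b ∈ S, v a ≤ v q ∧ v q ≤ v b) → u q ≤ u x

/-- In the frame `u, v`, the entry `x` is the furthest right pin for `y` and `S`, and it separates
`y`, which lies above, from `S`, which lies below. -/
def IsRightProperPin {n : ℕ} (u v : Fin n → ℤ) (x y : Fin n) (S : List (Fin n)) : Prop :=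
  u y < u x ∧ v x < v y ∧ (∀ a ∈ S, u a < u x ∧ v a < v x) ∧
    ∀ q, (∃ a ∈ S, v a ≤ v q) → v q ≤ v y → u q ≤ u x

/-- A list built from `[p₂, p₁]` by adding pins that are furthest in their direction. -/
inductive IsMaxPinList {n : ℕ} (π : Equiv.Perm (Fin n)) (p₁ p₂ : Fin n) : List (Fin n) → Prop
  | base : IsMaxPinList π p₁ p₂ [p₂, p₁]
  | cons {x : Fin n} {l : List (Fin n)} {u v : Fin n → ℤ} : IsFrame π u v →
      IsRightMaxPin u v l x → IsMaxPinList π p₁ p₂ l → IsMaxPinList π p₁ p₂ (x :: l)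

/-- A list built from `[p₂, p₁]` by adding furthest pins that satisfy the separation condition. -/
inductive IsProperPinList {n : ℕ} (π : Equiv.Perm (Fin n)) (p₁ p₂ : Fin n) :
    List (Fin n) → Prop
  | base : IsProperPinList π p₁ p₂ [p₂, p₁]
  | cons {x y : Fin n} {S : List (Fin n)} {u v : Fin n → ℤ} : IsFrame π u v →
      IsRightProperPin u v x y S → S ≠ [] → IsProperPinList π p₁ p₂ (y :: S) →
      IsProperPinList π p₁ p₂ (x :: y :: S)

section PinLists

variable {n : ℕ} {π : Equiv.Perm (Fin n)} {u v : Fin n → ℤ} {p₁ p₂ : Fin n}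

theorem IsRightProperPin.mono {x y : Fin n} {S T : List (Fin n)}
    (h : IsRightProperPin u v x y T) (hST : S ⊆ T) : IsRightProperPin u v x y S :=
  ⟨h.1, h.2.1, fun a ha => h.2.2.1 a (hST ha),
    fun q ⟨a, ha, haq⟩ hq => h.2.2.2 q ⟨a, hST ha, haq⟩ hq⟩

/-- As S lies below x and x below y, the strip from S up to y is the whole extent of `y :: S`, so
both notions of maximality range over the same candidates. -/
theorem IsRightProperPin.isRightMaxPin {x y : Fin n} {S : List (Fin n)}
    (h : IsRightProperPin u v x y S) (hS : S ≠ []) : IsRightMaxPin u v (y :: S) x := by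
  obtain ⟨h1, h2, h3, h4⟩ := h
  obtain ⟨s, hs⟩ := List.exists_mem_of_ne_nil S hS
  refine ⟨⟨s, by simp [hs], y, by simp, (h3 s hs).2, h2⟩, ?_, ?_⟩
  · intro a ha
    rcases List.mem_cons.1 ha with rfl | ha
    · exact h1
    · exact (h3 a ha).1
  · rintro q ⟨a, ha, b, hb, haq, hqb⟩
    refine h4 q ?_ ?_
    · rcases List.mem_cons.1 ha with rfl | ha
      · exact ⟨s, hs, by linarith [(h3 s hs).2]⟩
      · exact ⟨a, ha, haq⟩
    · rcases List.mem_cons.1 hb with rfl | hb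
      · exact hqb
      · linarith [(h3 b hb).2]

/-- A furthest pin is a separating one for a shorter list. -/
theorem IsMaxPinList.exists_suffix {l : List (Fin n)} (hl : IsMaxPinList π p₁ p₂ l)
    (h : IsFrame π u v) {x : Fin n} (hx : IsRightMaxPin u v l x) :
    ∃ u' v' y S, IsFrame π u' v' ∧ (y :: S) <:+ l ∧ S ≠ [] ∧ IsRightProperPin u' v' x y S := by
  have two : ∀ (y : Fin n) (S : List (Fin n)), S ≠ [] → IsRightMaxPin u v (y :: S) x →
      (¬∃ a ∈ S, ∃ b ∈ S, v a < v x ∧ v x < v b) →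
      ∃ u' v', IsFrame π u' v' ∧ IsRightProperPin u' v' x y S := by
    intro y S hS ⟨h1, h2, h3⟩ hnot
    push Not at hnot
    have hne : ∀ a ∈ S, v a ≠ v x := fun a ha e => by
      have := h2 a (by simp [ha])
      rw [h.injective_snd e] at this
      exact lt_irrefl _ this
    have hux : ∀ a ∈ S, u a < u x := fun a ha => h2 a (by simp [ha])
    obtain ⟨a, ha, b, hb, hax, hxb⟩ := h1
    rcases List.mem_cons.1 ha with rfl | haS
    · rcases List.mem_cons.1 hb with rfl | hbS
      · exact absurd (hax.trans hxb) (lt_irrefl _)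
      · refine ⟨u, fun i => -v i, h.neg_snd, h2 a (by simp), neg_lt_neg hax, ?_, ?_⟩
        · refine fun c hc => ⟨hux c hc, neg_lt_neg ?_⟩
          exact lt_of_le_of_ne (not_lt.1 fun hc' => absurd hxb
            (not_lt.2 (hnot c hc b hbS hc'))) (hne c hc).symm
        · rintro q ⟨c, hc, hcq⟩ hqa
          exact h3 q ⟨a, by simp, c, by simp [hc], neg_le_neg_iff.1 hqa, neg_le_neg_iff.1 hcq⟩
    · rcases List.mem_cons.1 hb with rfl | hbS
      · refine ⟨u, v, h, h2 b (by simp), hxb, ?_, ?_⟩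
        · refine fun c hc => ⟨hux c hc, ?_⟩
          exact lt_of_le_of_ne (hnot a haS c hc hax) (hne c hc)
        · rintro q ⟨c, hc, hcq⟩ hqb
          exact h3 q ⟨c, by simp [hc], b, by simp, hcq, hqb⟩
      · exact absurd hxb (not_lt.2 (hnot a haS b hbS hax))
  induction hl with
  | base =>
    obtain ⟨u', v', h1, h2⟩ := two p₂ [p₁] (by simp) hx (by
      rintro ⟨a, ha, b, hb, h1, h2⟩
      rw [List.mem_singleton] at ha hb
      subst ha hb
      exact absurd (h1.trans h2) (lt_irrefl _))
    exact ⟨u', v', p₂, [p₁], h1, List.suffix_rfl, by simp, h2⟩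
  | @cons y l _ _ _ _ hl ih =>
    -- If x already cuts l, then y is superfluous and x is a furthest pin for l as well. Otherwise x
    -- separates y from l. The descent stops at two points, because a single point cannot be cut.
    by_cases hb : ∃ a ∈ l, ∃ b ∈ l, v a < v x ∧ v x < v b
    · obtain ⟨u', v', z, S, h1, h2, h3⟩ := ih ⟨hb, fun a ha => hx.2.1 a (by simp [ha]),
        fun q ⟨a, ha, b, hb, hab⟩ => hx.2.2 q ⟨a, by simp [ha], b, by simp [hb], hab⟩⟩
      exact ⟨u', v', z, S, h1, h2.trans (List.suffix_cons y l), h3⟩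
    · have hne : l ≠ [] := by cases hl <;> simp
      obtain ⟨u', v', h1, h2⟩ := two y l hne hx hb
      exact ⟨u', v', y, l, h1, List.suffix_rfl, hne, h2⟩

/-- Every furthest-pin list has a proper sublist with the same two ends. -/
theorem IsMaxPinList.exists_proper {l : List (Fin n)} (hl : IsMaxPinList π p₁ p₂ l) :
    ∀ y S, (y :: S) <:+ l → S ≠ [] →
      ∃ S', S' ≠ [] ∧ S' ⊆ S ∧ IsProperPinList π p₁ p₂ (y :: S') := by
  induction hl with
  | base =>
    intro y S h hS
    rcases List.suffix_cons_iff.1 h with h | h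
    · obtain ⟨rfl, rfl⟩ := List.cons.inj h
      exact ⟨[p₁], by simp, by simp, .base⟩
    · exfalso
      have := h.length_le
      have h2 := List.length_pos_iff.2 hS
      simp only [List.length_cons, List.length_nil] at this
      omega
  | @cons x l u v hf hx hl ih =>
    intro y S h hS
    rcases List.suffix_cons_iff.1 h with h | h
    · obtain ⟨rfl, rfl⟩ := List.cons.inj h
      obtain ⟨u', v', z, T, hf', hsuf, hT, hz⟩ := hl.exists_suffix hf hx
      obtain ⟨T', h1, h2, h3⟩ := ih z T hsuf hT
      -- The proper list reaching z may have lost points of T, but x stays a proper pin over the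
      -- smaller set.
      refine ⟨z :: T', by simp, ?_, .cons hf' (hz.mono h2) h1 h3⟩
      intro a ha
      rcases List.mem_cons.1 ha with rfl | ha
      · exact hsuf.subset (by simp)
      · exact hsuf.subset (by simp [h2 ha])
    · exact ih y S h hS

theorem IsMaxPinList.nodup (hp : p₁ ≠ p₂) {l : List (Fin n)} (hl : IsMaxPinList π p₁ p₂ l) :
    l.Nodup := by
  induction hl with
  | base => simpa using hp.symm
  | cons _ hx _ ih => exact List.nodup_cons.2 ⟨fun h => lt_irrefl _ (hx.2.1 _ h), ih⟩

theorem IsMaxPinList.mem {l : List (Fin n)} (hl : IsMaxPinList π p₁ p₂ l) :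
    p₁ ∈ l ∧ p₂ ∈ l := by
  induction hl with
  | base => simp
  | cons _ _ _ ih => simp [ih]

/-- This ensures that a target other than `p₁` has something below it in the list. -/
theorem IsMaxPinList.eq_of_suffix_singleton {l : List (Fin n)} (hl : IsMaxPinList π p₁ p₂ l)
    {w : Fin n} (h : [w] <:+ l) : w = p₁ := by
  induction hl with
  | base =>
    obtain ⟨s, hs⟩ := h
    have := congrArg List.getLast? hs
    simpa using this
  | @cons x l _ _ _ _ hl ih =>
    rcases List.suffix_cons_iff.1 h with h | h
    · have h2 := (List.cons.inj h).2
      rw [← h2] at hl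
      cases hl
    · exact ih h

/-- A set of entries beside which there is a right pin has a furthest one. -/
theorem exists_isRightMaxPin (h : IsFrame π u v) {l : List (Fin n)} {q : Fin n}
    (hq : ∃ a ∈ l, ∃ b ∈ l, v a ≤ v q ∧ v q ≤ v b) (hu : ∀ a ∈ l, u a < u q) :
    ∃ x, IsRightMaxPin u v l x := by
  classical
  obtain ⟨x, hx, hmax⟩ := Finset.exists_max_image
    (Finset.univ.filter fun q => ∃ a ∈ l, ∃ b ∈ l, v a ≤ v q ∧ v q ≤ v b) u
    ⟨q, by simpa using hq⟩
  simp only [Finset.mem_filter, Finset.mem_univ, true_and] at hx hmax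
  have hux : ∀ a ∈ l, u a < u x := fun a ha => (hu a ha).trans_le (hmax q hq)
  have hne : ∀ a ∈ l, v a ≠ v x := fun a ha e => by
    have := hux a ha
    rw [h.injective_snd e] at this
    exact lt_irrefl _ this
  obtain ⟨a, ha, b, hb, h1, h2⟩ := hx
  exact ⟨x, ⟨a, ha, b, hb, lt_of_le_of_ne h1 (hne a ha), lt_of_le_of_ne h2 (hne b hb).symm⟩,
    hux, hmax⟩

/-- In a simple permutation a set of entries without pins contains every extreme entry. -/
theorem mem_of_no_pin (hπ : IsSimple π) (hp : p₁ ≠ p₂) {l : List (Fin n)} (h1 : p₁ ∈ l)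
    (h2 : p₂ ∈ l) (hno : ∀ u v, IsFrame π u v → ∀ x, ¬IsRightMaxPin u v l x)
    (h : IsFrame π u v) {w : Fin n} (hw : ∀ q, u q ≤ u w) : w ∈ l := by
  have key : ∀ u v, IsFrame π u v → ∀ q, (∃ a ∈ l, ∃ b ∈ l, v a ≤ v q ∧ v q ≤ v b) →
      ∃ a ∈ l, u q ≤ u a := by
    intro u v h q hq
    by_contra hcon
    push Not at hcon
    obtain ⟨x, hx⟩ := exists_isRightMaxPin h hq hcon
    exact hno u v h x hx
  have key2 : ∀ u v, IsFrame π u v → ∀ q, (∃ a ∈ l, ∃ b ∈ l, v a ≤ v q ∧ v q ≤ v b) →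
      ∃ a ∈ l, ∃ b ∈ l, u a ≤ u q ∧ u q ≤ u b := by
    intro u v h q hq
    obtain ⟨a, ha, ha'⟩ := key _ _ h.neg q hq
    obtain ⟨b, hb, hb'⟩ := key _ _ h q hq
    exact ⟨a, ha, b, hb, neg_le_neg_iff.1 ha', hb'⟩
  have hb := IsFrame.base (π := π)
  let I : Set (Fin n) := {q | ∃ a ∈ l, ∃ b ∈ l, a ≤ q ∧ q ≤ b}
  -- Without pins, lying among l horizontally and vertically are equivalent, so the horizontal hull
  -- of l is an interval.
  have hI : ∀ q, q ∈ I ↔ ∃ a ∈ l, ∃ b ∈ l, π a ≤ π q ∧ π q ≤ π b := by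
    intro q
    constructor
    · intro hq
      simpa using key2 _ _ hb.swap q (by simpa [I] using hq)
    · intro hq
      simpa [I] using key2 _ _ hb q (by simpa using hq)
  have hint : IsInterval π I := by
    constructor
    · rw [Set.ordConnected_iff]
      rintro q ⟨a, ha, -, -, haq, -⟩ r ⟨-, -, b, hb, -, hrb⟩ - t ⟨hqt, htr⟩
      exact ⟨a, ha, b, hb, haq.trans hqt, htr.trans hrb⟩
    · rw [Set.ordConnected_iff]
      rintro _ ⟨q, hq, rfl⟩ _ ⟨r, hr, rfl⟩ - t ⟨hqt, htr⟩
      obtain ⟨a, ha, -, -, haq, -⟩ := (hI q).1 hq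
      obtain ⟨-, -, b, hb, -, hrb⟩ := (hI r).1 hr
      refine ⟨π.symm t, (hI _).2 ⟨a, ha, b, hb, ?_, ?_⟩, by simp⟩
      · simpa using haq.trans hqt
      · simpa using htr.trans hrb
  have hIuniv : I = Set.univ := by
    have hcard : 1 < I.ncard := by
      rw [Set.one_lt_ncard]
      exact ⟨p₁, ⟨p₁, h1, p₁, h1, le_rfl, le_rfl⟩, p₂, ⟨p₂, h2, p₂, h2, le_rfl, le_rfl⟩, hp⟩
    rcases hπ I hint with h0 | h0 | h0
    · omega
    · omega
    · apply Set.eq_of_subset_of_ncard_le (Set.subset_univ I)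
      rw [h0, Set.ncard_univ, Nat.card_eq_fintype_card, Fintype.card_fin]
  have hwI : w ∈ I := hIuniv ▸ Set.mem_univ w
  have hall : ∀ b, ∃ a ∈ l, ∃ c ∈ l, coord π b a ≤ coord π b w ∧ coord π b w ≤ coord π b c := by
    intro b
    cases b
    · simpa [coord] using (hI w).1 hwI
    · simpa [coord, I] using hwI
  -- An extreme entry among l shares its extreme coordinate with a member of l, hence is that
  -- member.
  obtain ⟨⟨b, s, t⟩, rfl, rfl⟩ := h.exists_code
  obtain ⟨a, ha, c, hc, h3, h4⟩ := hall b
  have hinj := coord_injective π b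
  cases s
  · have := hw a
    simp only [frameFst, signed, Bool.false_eq_true, if_false] at this
    have e : a = w := hinj (by linarith)
    exact e ▸ ha
  · have := hw c
    simp only [frameFst, signed, if_true] at this
    have e : c = w := hinj (by linarith)
    exact e ▸ hc

/-- From any two entries of a simple permutation a proper pin sequence reaches any extreme entry
other than the first of them. -/
theorem exists_isProperPinList (hπ : IsSimple π) (hp : p₁ ≠ p₂) (h : IsFrame π u v) {w : Fin n}
    (hw : ∀ q, u q ≤ u w) (hwp : w ≠ p₁) : ∃ S, IsProperPinList π p₁ p₂ (w :: S) := by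
  -- Pin lists have no repetitions, so at most d further pins can be added.
  have hgrow : ∀ d, ∀ l, IsMaxPinList π p₁ p₂ l → n ≤ l.length + d →
      ∃ l', IsMaxPinList π p₁ p₂ l' ∧ ∀ u v, IsFrame π u v → ∀ x, ¬IsRightMaxPin u v l' x := by
    intro d
    induction d with
    | zero =>
      intro l hl hn
      refine ⟨l, hl, fun u v hf x hx => ?_⟩
      have := ((IsMaxPinList.cons hf hx hl).nodup hp).length_le_card
      simp at this
      omega
    | succ d ih =>
      intro l hl hn
      by_cases hex : ∃ u v, IsFrame π u v ∧ ∃ x, IsRightMaxPin u v l x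
      · obtain ⟨u, v, hf, x, hx⟩ := hex
        exact ih (x :: l) (.cons hf hx hl) (by simp; omega)
      · push Not at hex
        exact ⟨l, hl, hex⟩
  obtain ⟨l, hl, hno⟩ := hgrow n _ .base (by simp)
  have hwl := mem_of_no_pin hπ hp hl.mem.1 hl.mem.2 hno h hw
  obtain ⟨s, S, rfl⟩ := List.append_of_mem hwl
  have hsuf : (w :: S) <:+ s ++ w :: S := List.suffix_append _ _
  have hS : S ≠ [] := by
    rintro rfl
    exact hwp (hl.eq_of_suffix_singleton hsuf)
  obtain ⟨S', -, -, h3⟩ := hl.exists_proper w S hsuf hS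
  exact ⟨S', h3⟩

end PinLists

/-! ### From lists to proper pin sequences -/

section Sequences

variable {n : ℕ} {π : Equiv.Perm (Fin n)} {u v : Fin n → ℤ} {p₁ p₂ : Fin n}

/-- The point of the plot with a given position. -/
def point (π : Equiv.Perm (Fin n)) (i : Fin n) : Fin n × Fin n := (i, π i)

/-- The points of the plot with positions in a list. -/
def points (π : Equiv.Perm (Fin n)) (l : List (Fin n)) : Set (Fin n × Fin n) :=
  {q | ∃ a ∈ l, point π a = q}

theorem point_injective : Function.Injective (point π) := fun _ _ h => (Prod.ext_iff.1 h).1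

theorem subset_rect (S : Set (Fin n × Fin n)) : S ⊆ rect S :=
  fun a ha => ⟨⟨a, ha, a, ha, le_rfl, le_rfl⟩, ⟨a, ha, a, ha, le_rfl, le_rfl⟩⟩

theorem isPin_of_isRightMaxPin (h : IsFrame π u v) {l : List (Fin n)} {x : Fin n}
    (hx : IsRightMaxPin u v l x) : IsPin (points π l) (point π x) := by
  obtain ⟨⟨a, ha, b, hb, hax, hxb⟩, h2, -⟩ := hx
  obtain ⟨⟨c, s, t⟩, rfl, rfl⟩ := h.exists_code
  have hout : ∀ a' ∈ l, ∀ b' ∈ l, coord π c a' ≤ coord π c x → coord π c x ≤ coord π c b' →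
      False := by
    intro a' ha' b' hb' h3 h4
    have h5 := h2 a' ha'
    have h6 := h2 b' hb'
    cases s <;> simp only [frameFst, signed, if_true, if_false, Bool.false_eq_true] at h5 h6 <;>
      linarith
  have hamong : ∃ a ∈ l, ∃ b ∈ l, coord π (!c) a ≤ coord π (!c) x ∧
      coord π (!c) x ≤ coord π (!c) b := by
    cases t <;> simp only [frameSnd, signed, if_true, if_false, Bool.false_eq_true] at hax hxb
    · exact ⟨b, hb, a, ha, by linarith, by linarith⟩
    · exact ⟨a, ha, b, hb, hax.le, hxb.le⟩
  obtain ⟨a', ha', b', hb', h3, h4⟩ := hamong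
  cases c
  · refine ⟨?_, Or.inl ⟨_, ⟨a', ha', rfl⟩, _, ⟨b', hb', rfl⟩, ?_, ?_⟩⟩
    · rintro ⟨-, _, ⟨a, ha, rfl⟩, _, ⟨b, hb, rfl⟩, h5, h6⟩
      exact hout a ha b hb (by simpa [coord, point] using h5) (by simpa [coord, point] using h6)
    · simpa [coord, point] using h3
    · simpa [coord, point] using h4
  · refine ⟨?_, Or.inr ⟨_, ⟨a', ha', rfl⟩, _, ⟨b', hb', rfl⟩, ?_, ?_⟩⟩
    · rintro ⟨⟨_, ⟨a, ha, rfl⟩, _, ⟨b, hb, rfl⟩, h5, h6⟩, -⟩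
      exact hout a ha b hb (by simpa [coord, point] using h5) (by simpa [coord, point] using h6)
    · simpa [coord, point] using h3
    · simpa [coord, point] using h4

/-- The frame in which a direction points to the right. -/
def directionCode : Direction → Bool × Bool × Bool
  | .up => (false, true, true)
  | .down => (false, false, true)
  | .left => (true, false, true)
  | .right => (true, true, true)

theorem atLeastAsFar_iff (d : Direction) (i j : Fin n) :
    AtLeastAsFar d (point π i) (point π j) ↔
      frameFst π (directionCode d) j ≤ frameFst π (directionCode d) i := by
  cases d <;> simp [AtLeastAsFar, frameFst, directionCode, signed, coord, point]

theorem LiesBeyond.lt {d : Direction} {l : List (Fin n)} {x : Fin n}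
    (h : LiesBeyond d (rect (points π l)) (point π x)) {a : Fin n} (ha : a ∈ l) :
    frameFst π (directionCode d) a < frameFst π (directionCode d) x := by
  have hmem : point π a ∈ rect (points π l) := subset_rect _ ⟨a, ha, rfl⟩
  cases d <;> simpa [frameFst, directionCode, signed, coord, point] using h _ hmem

/-- A point beyond l in direction d is not among l along that axis, so it must be among l along the
other one. -/
theorem IsPinInDirection.among {d : Direction} {l : List (Fin n)} {x : Fin n}
    (h : IsPinInDirection d (points π l) (point π x)) :
    ∃ a ∈ l, ∃ b ∈ l, frameSnd π (directionCode d) a ≤ frameSnd π (directionCode d) x ∧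
      frameSnd π (directionCode d) x ≤ frameSnd π (directionCode d) b := by
  have hb := fun a (ha : a ∈ l) => h.2.lt ha
  cases d <;> rcases h.1.2 with ⟨_, ⟨a, ha, rfl⟩, _, ⟨b, hb', rfl⟩, h1, h2⟩ |
    ⟨_, ⟨a, ha, rfl⟩, _, ⟨b, hb', rfl⟩, h1, h2⟩
  all_goals
    first
    | refine ⟨a, ha, b, hb', ?_, ?_⟩
      · simpa [frameSnd, directionCode, signed, coord, point] using h1
      · simpa [frameSnd, directionCode, signed, coord, point] using h2
    | exfalso
      have h3 := hb a ha
      have h4 := hb b hb'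
      simp [frameFst, directionCode, signed, coord, point] at h1 h2 h3 h4
      omega

/-- A furthest right pin of a frame is furthest among the pins in its direction. -/
theorem IsRightMaxPin.atLeastAsFar (h : IsFrame π u v) {l : List (Fin n)} {x : Fin n}
    (hx : IsRightMaxPin u v l x) {d : Direction}
    (hd : IsPinInDirection d (points π l) (point π x)) {q : Fin n}
    (hq : IsPinInDirection d (points π l) (point π q)) :
    AtLeastAsFar d (point π x) (point π q) := by
  rw [atLeastAsFar_iff]
  have hb := fun a (ha : a ∈ l) => hd.2.lt ha
  have hq' := hq.among
  have hf := isFrame_code π (directionCode d)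
  generalize frameFst π (directionCode d) = u', frameSnd π (directionCode d) = v' at *
  obtain ⟨⟨a, ha, b, hb', h1, h2⟩, h3, h4⟩ := hx
  obtain ⟨a', ha', b', hb'', h5, h6⟩ := hq'
  have hxa := hb a ha
  have hxb := hb b hb'
  have hua := h3 a ha
  -- The frame of d must have the same first coordinate: in any other, x would not be beyond all of
  -- l.
  rcases h.comparable hf with ⟨rfl | rfl, rfl | rfl⟩ | ⟨rfl | rfl, -⟩
  · exact h4 q ⟨a', ha', b', hb'', h5, h6⟩
  · exact h4 q ⟨b', hb'', a', ha', neg_le_neg_iff.1 h6, neg_le_neg_iff.1 h5⟩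
  · simp only at hxa; omega
  · simp only at hxa; omega
  · omega
  · simp only at hxa; omega

theorem separates_of_isRightProperPin (h : IsFrame π u v) {l : List (Fin n)} {x y : Fin n}
    (hx : IsRightProperPin u v x y l) :
    Separates (point π x) (point π y) (rect (points π l)) := by
  obtain ⟨-, hxy, h2, -⟩ := hx
  replace h2 := fun a ha => (h2 a ha).2
  obtain ⟨⟨c, s, t⟩, rfl, rfl⟩ := h.exists_code
  cases c <;> cases t <;> simp [frameSnd, signed, coord] at hxy h2
  · right; left
    rintro q ⟨⟨_, ⟨a, ha, rfl⟩, -, -, h3, -⟩, -⟩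
    exact ⟨hxy, (h2 a ha).trans_le h3⟩
  · left
    rintro q ⟨⟨-, -, _, ⟨a, ha, rfl⟩, -, h3⟩, -⟩
    exact ⟨lt_of_le_of_lt h3 (h2 a ha), hxy⟩
  · right; right; right
    rintro q ⟨-, ⟨_, ⟨a, ha, rfl⟩, -, -, h3, -⟩⟩
    exact ⟨hxy, (h2 a ha).trans_le h3⟩
  · right; right; left
    rintro q ⟨-, ⟨-, -, _, ⟨a, ha, rfl⟩, -, h3⟩⟩
    exact ⟨lt_of_le_of_lt h3 (h2 a ha), hxy⟩

theorem IsProperPinList.nodup (hp : p₁ ≠ p₂) {l : List (Fin n)} (hl : IsProperPinList π p₁ p₂ l) :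
    l.Nodup := by
  induction hl with
  | base => simpa using hp.symm
  | cons _ hx hS _ ih =>
    exact List.nodup_cons.2 ⟨fun h => lt_irrefl _ ((hx.isRightMaxPin hS).2.1 _ h), ih⟩

/-- The suffixes of a proper list satisfy the conditions at their head. -/
theorem IsProperPinList.of_suffix {l : List (Fin n)} (hl : IsProperPinList π p₁ p₂ l) :
    ∀ x y S, (x :: y :: S) <:+ l → S = [] ∨
      ∃ u v, IsFrame π u v ∧ IsRightProperPin u v x y S := by
  induction hl with
  | base =>
    intro x y S h
    left
    have := h.length_le
    simp only [List.length_cons, List.length_nil] at this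
    exact List.length_eq_zero_iff.1 (by omega)
  | @cons x y S u v hf hx _ _ ih =>
    intro x' y' S' h
    rcases List.suffix_cons_iff.1 h with h | h
    · simp only [List.cons.injEq] at h
      obtain ⟨rfl, rfl, rfl⟩ := h
      exact Or.inr ⟨u, v, hf, hx⟩
    · exact ih _ _ _ h

theorem IsProperPinList.exists_sequence (hp : p₁ ≠ p₂) {l : List (Fin n)}
    (hl : IsProperPinList π p₁ p₂ l) {m : ℕ} (hm : m ≤ l.length) :
    ∃ p : Fin m → Fin n × Fin n, IsProperPinSequence π p := by
  -- The list has its latest pin first. Each condition looks only backwards, so the first m terms of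
  -- the reversed list suffice.
  let r := l.reverse
  have hr : r.length = l.length := List.length_reverse
  let p : Fin m → Fin n × Fin n := fun i => point π (r[(i : ℕ)]'(by omega))
  have hnd : r.Nodup := List.nodup_reverse.2 (hl.nodup hp)
  have hinj : Function.Injective p := by
    intro i j hij
    have := point_injective hij
    rw [hnd.getElem_inj_iff] at this
    exact Fin.ext this
  have hbefore : ∀ i : Fin m, before p i = points π (r.take i).reverse := by
    intro i
    ext q
    simp only [before, points, Set.mem_image, Set.mem_Iio, Set.mem_ofPred_eq, List.mem_reverse,
      List.mem_take_iff_getElem]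
    constructor
    · rintro ⟨j, hj, rfl⟩
      have := Fin.lt_def.1 hj
      exact ⟨_, ⟨j, by omega, rfl⟩, rfl⟩
    · rintro ⟨_, ⟨j, hj, rfl⟩, rfl⟩
      exact ⟨⟨j, by omega⟩, Fin.lt_def.2 (by simp; omega), rfl⟩
  have hsuf : ∀ i, (r.take i).reverse <:+ l := by
    intro i
    have := (List.take_prefix i r).reverse
    rwa [List.reverse_reverse] at this
  have hsucc : ∀ i (hi : i < r.length), (r.take (i + 1)).reverse = r[i] :: (r.take i).reverse := by
    intro i hi
    rw [List.take_succ_eq_append_getElem hi]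
    simp
  have hpin : ∀ i (hi : i + 1 < r.length), 1 ≤ i → ∃ u v, IsFrame π u v ∧
      IsRightProperPin u v r[i + 1] r[i] (r.take i).reverse ∧ (r.take i).reverse ≠ [] := by
    intro i hi h1
    have h2 := hsuf (i + 1 + 1)
    rw [hsucc _ hi, hsucc i (by omega)] at h2
    have h3 : (r.take i).reverse ≠ [] := by
      rw [← List.length_pos_iff, List.length_reverse, List.length_take]
      omega
    rcases hl.of_suffix _ _ _ h2 with h4 | ⟨u, v, h4, h5⟩
    · exact absurd h4 h3
    · exact ⟨u, v, h4, h5, h3⟩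
  have hmax : ∀ i : Fin m, 2 ≤ (i : ℕ) → ∃ u v x, IsFrame π u v ∧ p i = point π x ∧
      before p i = points π (r.take i).reverse ∧ IsRightMaxPin u v (r.take i).reverse x := by
    intro i hi
    obtain ⟨j, hj⟩ : ∃ j, (i : ℕ) = j + 1 := ⟨i - 1, by omega⟩
    obtain ⟨u, v, h1, h2, h3⟩ := hpin j (by omega) (by omega)
    refine ⟨u, v, r[j + 1]'(by omega), h1, ?_, hbefore i, ?_⟩
    · simp only [p, hj]
    · rw [hj, hsucc j (by omega)]
      exact h2.isRightMaxPin h3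
  refine ⟨p, ⟨fun i => ⟨_, rfl⟩, hinj, ?_⟩, ?_, ?_⟩
  · intro i hi
    obtain ⟨u, v, x, h1, h2, h3, h4⟩ := hmax i hi
    rw [h2, h3]
    exact isPin_of_isRightMaxPin h1 h4
  · rintro i hi d hd _ ⟨q, rfl⟩ hq
    obtain ⟨u, v, x, h1, h2, h3, h4⟩ := hmax i hi
    rw [h2, h3] at hd
    rw [h3] at hq
    rw [h2]
    exact h4.atLeastAsFar h1 hd hq
  · intro i j hi hj
    obtain ⟨u, v, h1, h2, -⟩ := hpin i (by omega) hi
    have := separates_of_isRightProperPin h1 h2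
    rw [hbefore i]
    simpa only [p, hj] using this

end Sequences

/-! ### Monotone subsequences -/

section Monotone

variable {α : Type*}

/-- The Erdős–Szekeres theorem for a finite set with two injective coordinates. -/
theorem exists_monotone_subset (u v : α → ℤ) (r s : ℕ) :
    ∀ J : Finset α, Set.InjOn u J → Set.InjOn v J → r * s < J.card → ∃ T ⊆ J,
      (T.card = r + 1 ∧ ∀ y ∈ T, ∀ z ∈ T, u y < u z → v y < v z) ∨
        (T.card = s + 1 ∧ ∀ y ∈ T, ∀ z ∈ T, u y < u z → v z < v y) := by
  classical
  induction r with
  | zero =>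
    intro J _ _ hJ
    obtain ⟨y, hy⟩ := Finset.card_pos.1 (by omega : 0 < J.card)
    refine ⟨{y}, by simpa using hy, Or.inl ⟨by simp, ?_⟩⟩
    intro a ha b hb h
    rw [Finset.mem_singleton] at ha hb
    subst ha hb
    exact absurd h (lt_irrefl _)
  | succ r ih =>
    intro J hu hv hJ
    -- The left-to-right minima of J form a decreasing set.
    let D := J.filter fun y => ∀ z ∈ J, u z < u y → v y ≤ v z
    by_cases hD : s + 1 ≤ D.card
    · obtain ⟨T, hT, hcard⟩ := Finset.exists_subset_card_eq hD
      refine ⟨T, hT.trans (Finset.filter_subset _ _), Or.inr ⟨hcard, ?_⟩⟩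
      intro y hy z hz hyz
      obtain ⟨hyJ, -⟩ := Finset.mem_filter.1 (hT hy)
      obtain ⟨hzJ, hzD⟩ := Finset.mem_filter.1 (hT hz)
      refine lt_of_le_of_ne (hzD y hyJ hyz) fun e => ?_
      rw [hv hzJ hyJ e] at hyz
      exact lt_irrefl _ hyz
    · have hsub : J \ D ⊆ J := Finset.sdiff_subset
      have hcard : r * s < (J \ D).card := by
        have h1 : (J \ D).card + D.card = J.card :=
          Finset.card_sdiff_add_card_eq_card (Finset.filter_subset _ _)
        have h2 : (r + 1) * s = r * s + s := by ring
        omega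
      obtain ⟨T, hT, h | h⟩ := ih (J \ D) (hu.mono (by exact_mod_cast hsub))
        (hv.mono (by exact_mod_cast hsub)) hcard
      · obtain ⟨hTc, hinc⟩ := h
        obtain ⟨t, ht, hmin⟩ := Finset.exists_min_image T u (Finset.card_pos.1 (by omega))
        have htJ := Finset.mem_sdiff.1 (hT ht)
        -- The leftmost point of T is not a left-to-right minimum, so T can be extended to the left
        -- and below.
        have : ∃ z ∈ J, u z < u t ∧ v z < v t := by
          by_contra hcon
          push Not at hcon
          exact htJ.2 (Finset.mem_filter.2 ⟨htJ.1, hcon⟩)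
        obtain ⟨z, hz, hzu, hzv⟩ := this
        have hzT : z ∉ T := fun h => absurd (hmin z h) (not_le.2 hzu)
        refine ⟨insert z T, Finset.insert_subset hz (hT.trans hsub),
          Or.inl ⟨by rw [Finset.card_insert_of_notMem hzT, hTc], ?_⟩⟩
        have hvt : ∀ a ∈ T, v t ≤ v a := by
          intro a ha
          rcases lt_or_eq_of_le (hmin a ha) with h1 | h1
          · exact (hinc t ht a ha h1).le
          · rw [hu htJ.1 (hsub (hT ha)) h1]
        intro a ha b hb hab
        rcases Finset.mem_insert.1 ha with rfl | ha'
        · rcases Finset.mem_insert.1 hb with rfl | hb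
          · exact absurd hab (lt_irrefl _)
          · exact hzv.trans_le (hvt b hb)
        · rcases Finset.mem_insert.1 hb with rfl | hb
          · exact absurd (hab.trans hzu) (not_lt.2 (hmin a ha'))
          · exact hinc a ha' b hb hab
      · exact ⟨T, hT.trans hsub, Or.inr h⟩

/-- A finite set can be listed in increasing order of an injective coordinate. -/
theorem exists_enumeration [Nonempty α] (u : α → ℤ) (T : Finset α) (hu : Set.InjOn u T) :
    ∃ e : ℕ → α, (∀ i < T.card, e i ∈ T) ∧ ∀ i j, i < j → j < T.card → u (e i) < u (e j) := by
  classical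
  have hcard : (T.image u).card = T.card := Finset.card_image_of_injOn hu
  have hex : ∀ i : ℕ, ∃ a, ∀ h : i < T.card, a ∈ T ∧
      u a = (T.image u).orderEmbOfFin hcard ⟨i, h⟩ := by
    intro i
    by_cases h : i < T.card
    · obtain ⟨a, ha, hau⟩ := Finset.mem_image.1 ((T.image u).orderEmbOfFin_mem hcard ⟨i, h⟩)
      exact ⟨a, fun _ => ⟨ha, hau⟩⟩
    · exact ⟨Classical.arbitrary α, fun h' => absurd h' h⟩
  choose e he using hex
  refine ⟨e, fun i hi => (he i hi).1, fun i j hij hj => ?_⟩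
  rw [(he i (hij.trans hj)).2, (he j hj).2]
  exact ((T.image u).orderEmbOfFin hcard).strictMono (Fin.mk_lt_mk.2 hij)

end Monotone

/-! ### Wedges -/

section Core

variable {n k : ℕ} {π : Equiv.Perm (Fin n)} {u v : Fin n → ℤ}

theorem IsRightMaxPin.among {u' v' : Fin n → ℤ} (hf' : IsFrame π u' v') {l : List (Fin n)}
    {x : Fin n} (hx : IsRightMaxPin u' v' l x) (hf : IsFrame π u v) :
    (∃ a ∈ l, ∃ b ∈ l, v a < v x ∧ v x < v b) ∨ (∃ a ∈ l, ∃ b ∈ l, u a < u x ∧ u x < u b) := by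
  obtain ⟨a, ha, b, hb, h1, h2⟩ := hx.1
  rcases hf.comparable hf' with ⟨-, rfl | rfl⟩ | ⟨-, rfl | rfl⟩
  · exact Or.inl ⟨a, ha, b, hb, h1, h2⟩
  · exact Or.inl ⟨b, hb, a, ha, neg_lt_neg_iff.1 h2, neg_lt_neg_iff.1 h1⟩
  · exact Or.inr ⟨a, ha, b, hb, h1, h2⟩
  · exact Or.inr ⟨b, hb, a, ha, neg_lt_neg_iff.1 h2, neg_lt_neg_iff.1 h1⟩

/-- A wedge with many levels opening to the left is cut by a short proper pin sequence that starts
at its apex and leaves it, which gives a wedge simple permutation. -/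
theorem exists_wedgeSimple_of_apex (hπ : IsSimple π) (hk : 2 ≤ k)
    (hshort : ∀ p₁ p₂ l, p₁ ≠ p₂ → IsProperPinList π p₁ p₂ l → l.length < 2 * k)
    (hf : IsFrame π u v) (a b : ℕ → Fin n) {M : ℕ} (hM : (2 * k - 3) * k < M)
    (hab : ∀ i ≤ M, u (a i) < u (b i)) (hba : ∀ i j, i < j → j ≤ M → u (b i) < u (a j))
    (ha : ∀ i j, i < j → j ≤ M → v (a j) < v (a i))
    (hb : ∀ i j, i < j → j ≤ M → v (b i) < v (b j))
    (hsep : ∀ i j, i ≤ M → j ≤ M → v (b i) < v (a j)) :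
    ∃ σ : Equiv.Perm (Fin (2 * k)), IsWedgeSimple σ ∧ Contains π σ := by
  by_contra hcon
  -- Each pin after the two apex points crosses at most k levels: after s of them everything is
  -- still inside every level i with i + sk < M.
  have hinside : ∀ l, IsProperPinList π (a M) (b M) l → ∃ s, l.length = s + 2 ∧
      ∀ q ∈ l, ∀ i, i + s * k < M → u (b i) < u q ∧ v (b i) < v q ∧ v q < v (a i) := by
    intro l hl
    induction hl with
    | base =>
      refine ⟨0, rfl, fun q hq i hi => ?_⟩
      have hi' : i < M := by omega
      simp only [List.mem_cons, List.not_mem_nil, or_false] at hq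
      rcases hq with rfl | rfl
      · exact ⟨(hba i M hi' le_rfl).trans (hab M le_rfl), hb i M hi' le_rfl,
          hsep M i le_rfl hi'.le⟩
      · exact ⟨hba i M hi' le_rfl, hsep i M hi'.le le_rfl, ha i M hi' le_rfl⟩
    | @cons x y S u' v' hf' hx hS _ ih =>
      obtain ⟨s, hs, hin⟩ := ih
      refine ⟨s + 1, by simpa using hs, fun q hq i hi => ?_⟩
      have hi' : i + k + s * k < M := by
        have : (s + 1) * k = s * k + k := by ring
        omega
      have hsk : i + k < M := by
        have := Nat.zero_le (s * k)
        omega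
      have hlev : ∀ j ≤ i + k, ∀ q ∈ y :: S,
          u (b j) < u q ∧ v (b j) < v q ∧ v q < v (a j) :=
        fun j hj q hq => hin q hq j (by omega)
      rcases List.mem_cons.1 hq with rfl | hq
      swap
      · exact hlev i (by omega) q hq
      rcases (hx.isRightMaxPin hS).among hf' hf with ⟨c, hc, d, hd, hcx, hxd⟩ |
        ⟨c, hc, d, hd, hcx, hxd⟩
      · have hvx : ∀ j ≤ i + k, v (b j) < v q ∧ v q < v (a j) := fun j hj =>
          ⟨(hlev j hj c hc).2.1.trans hcx, hxd.trans (hlev j hj d hd).2.2⟩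
        refine ⟨?_, hvx i (by omega)⟩
        by_contra hux
        -- The pin leaves through the open end. After a half turn, levels i + k down to i + 1 form a
        -- wedge opening to the right, with the pin beyond it.
        refine hcon (hf.neg.neg_snd.exists_wedge₁ (k := k) (by omega)
          (fun t => b (i + k - t)) (fun t => a (i + k - t)) q ?_ ?_ ?_ ?_ ?_ ?_ ?_)
        · exact fun t ht => neg_lt_neg (hab _ (by omega))
        · exact fun t ht => neg_lt_neg (hba _ _ (by omega) (by omega))
        · refine neg_lt_neg ?_
          have h1 := hab (i + k - (k - 1)) (by omega)
          have h2 := hba i (i + k - (k - 1)) (by omega) (by omega)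
          linarith
        · exact fun t t' h1 h2 => neg_lt_neg (hb _ _ (by omega) (by omega))
        · exact fun t t' h1 h2 => neg_lt_neg (ha _ _ (by omega) (by omega))
        · exact fun t ht => neg_lt_neg (hvx _ (by omega)).2
        · exact fun t ht => neg_lt_neg (hvx _ (by omega)).1
      · have hux : ∀ j ≤ i + k, u (b j) < u q := fun j hj => (hlev j hj c hc).1.trans hcx
        refine ⟨hux i (by omega), ?_, ?_⟩
        · by_contra hvx
          -- The pin leaves below the wedge, and separates the earlier point d from the levels. In
          -- each level b lies nearer the apex than a; after the half turn b is the upper side,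
          -- which must come second, hence the shift by one level.
          refine hcon (hf.neg.neg_snd.exists_wedge₂ (k := k) hk
            (fun t => b (i + k - t - 1)) (fun t => a (i + k - t)) q d ?_ ?_ ?_ ?_ ?_ ?_ ?_ ?_ ?_)
          · exact neg_lt_neg hxd
          · exact neg_lt_neg ((hab _ (by omega)).trans (hux _ (by omega)))
          · exact fun t ht => neg_lt_neg (hba _ _ (by omega) (by omega))
          · intro t ht
            have e : i + k - (t + 1) = i + k - t - 1 := by omega
            simp only [e]
            exact neg_lt_neg (hab _ (by omega))
          · exact fun t t' h1 h2 => neg_lt_neg (hb _ _ (by omega) (by omega))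
          · exact fun t t' h1 h2 => neg_lt_neg (ha _ _ (by omega) (by omega))
          · exact fun t ht => neg_lt_neg (hlev _ (by omega) d hd).2.2
          · exact fun t ht => neg_lt_neg (hlev _ (by omega) d hd).2.1
          · intro t ht
            refine neg_lt_neg ?_
            have := hb i (i + k - t - 1) (by omega) (by omega)
            linarith
        · by_contra hvx
          -- The pin leaves above; a reflection suffices and the levels need no shift.
          refine hcon (hf.neg.exists_wedge₂ (k := k) hk
            (fun t => a (i + k - t)) (fun t => b (i + k - t)) q d ?_ ?_ ?_ ?_ ?_ ?_ ?_ ?_ ?_)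
          · exact neg_lt_neg hxd
          · exact neg_lt_neg (hux _ (by omega))
          · exact fun t ht => neg_lt_neg (hab _ (by omega))
          · exact fun t ht => neg_lt_neg (hba _ _ (by omega) (by omega))
          · exact fun t t' h1 h2 => ha _ _ (by omega) (by omega)
          · exact fun t t' h1 h2 => hb _ _ (by omega) (by omega)
          · exact fun t ht => (hlev _ (by omega) d hd).2.1
          · exact fun t ht => (hlev _ (by omega) d hd).2.2
          · intro t ht
            have := ha i (i + k - t) (by omega) (by omega)
            linarith
  have hM0 : 0 < M := by omega
  have : Nonempty (Fin n) := ⟨a 0⟩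
  obtain ⟨w, hw⟩ := Finite.exists_max fun i => -u i
  have hwM : w ≠ a M := by
    rintro rfl
    have h1 := hw (b 0)
    have h2 := hba 0 M hM0 le_rfl
    linarith
  have hne : a M ≠ b M := fun e => by
    have := hab M le_rfl
    rw [e] at this
    exact lt_irrefl _ this
  obtain ⟨S, hS⟩ := exists_isProperPinList hπ hne hf.neg hw hwM
  obtain ⟨s, hs, hin⟩ := hinside _ hS
  have hlen := hshort _ _ _ hne hS
  -- At most 2k - 3 pins follow the apex pair, so even the leftmost entry would lie to the right of
  -- `b 0`.
  have hsk : s * k ≤ (2 * k - 3) * k := Nat.mul_le_mul_right k (by omega)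
  have h1 := (hin w (by simp) 0 (by omega)).1
  have h2 := hw (b 0)
  linarith

/-- Many alternating points above and below `x`, both monotone. -/
theorem exists_of_levels (hπ : IsSimple π) (hk : 2 ≤ k)
    (hshort : ∀ p₁ p₂ l, p₁ ≠ p₂ → IsProperPinList π p₁ p₂ l → l.length < 2 * k)
    (hf : IsFrame π u v) (a b : ℕ → Fin n) (x : Fin n) {m : ℕ} (hm : 2 * k ^ 2 ≤ m + 1)
    (hab : ∀ i < m, u (a i) < u (b i)) (hba : ∀ i j, i < j → j < m → u (b i) < u (a j))
    (hax : ∀ i < m, u (a i) < u x ∧ v x < v (a i)) (hbx : ∀ i < m, v (b i) < v x)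
    (ha : (∀ i j, i < j → j < m → v (a i) < v (a j)) ∨
      (∀ i j, i < j → j < m → v (a j) < v (a i)))
    (hb : (∀ i j, i < j → j < m → v (b i) < v (b j)) ∨
      (∀ i j, i < j → j < m → v (b j) < v (b i))) :
    (∃ σ : Equiv.Perm (Fin (2 * k)), IsParallelAlternation σ ∧ Contains π σ) ∨
      (∃ σ : Equiv.Perm (Fin (2 * k)), IsWedgeSimple σ ∧ Contains π σ) := by
  have hkm : k + 2 ≤ m := by nlinarith
  have hpar : ((∀ i j, i < j → j < k → v (a i) < v (a j) ∧ v (b i) < v (b j)) ∨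
      (∀ i j, i < j → j < k → v (a j) < v (a i) ∧ v (b j) < v (b i))) →
      ∃ σ : Equiv.Perm (Fin (2 * k)), IsParallelAlternation σ ∧ Contains π σ :=
    hf.exists_parallel a b (fun i hi => hab i (by omega))
      (fun i hi => hba i (i + 1) (by omega) (by omega))
      (fun i hi j hj => (hbx i (by omega)).trans (hax j (by omega)).2)
  rcases ha with ha | ha <;> rcases hb with hb | hb
  · exact Or.inl (hpar (Or.inl fun i j hij hj => ⟨ha i j hij (by omega), hb i j hij (by omega)⟩))
  · exact Or.inr (hf.exists_wedge₁ (by omega) a b x (fun i hi => hab i (by omega))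
      (fun i hi => hba i (i + 1) (by omega) (by omega)) (hax _ (by omega)).1
      (fun i j hij hj => ha i j hij (by omega)) (fun i j hij hj => hb i j hij (by omega))
      (fun i hi => hbx i (by omega)) (fun i hi => (hax i (by omega)).2))
  · refine Or.inr (exists_wedgeSimple_of_apex hπ hk hshort hf a b (M := m - 1) ?_
      (fun i hi => hab i (by omega)) (fun i j hij hj => hba i j hij (by omega))
      (fun i j hij hj => ha i j hij (by omega)) (fun i j hij hj => hb i j hij (by omega))
      (fun i j hi hj => (hbx i (by omega)).trans (hax j (by omega)).2))
    -- This slack suffices for (2k - 3)k < m - 1, since m - 1 ≥ 2k^2 - 2 and k ≥ 2.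
    have h1 : (2 * k - 3) * k + 3 * k ≤ 2 * k ^ 2 + k := by
      have h2 : (2 * k - 3) * k ≤ (2 * k - 2) * k := Nat.mul_le_mul_right k (by omega)
      have h3 : (2 * k - 2) * k + 2 * k = 2 * k ^ 2 := by
        rw [← add_mul, Nat.sub_add_cancel (by omega)]
        ring
      omega
    omega
  · exact Or.inl (hpar (Or.inr fun i j hij hj => ⟨ha i j hij (by omega), hb i j hij (by omega)⟩))

/-- Many monotone points above `x`, each with a partner below `x` next to it on the same side. -/
theorem exists_of_partners (hπ : IsSimple π) (hk : 2 ≤ k)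
    (hshort : ∀ p₁ p₂ l, p₁ ≠ p₂ → IsProperPinList π p₁ p₂ l → l.length < 2 * k)
    (hf : IsFrame π u v) (x : Fin n) (T : Finset (Fin n)) (s : Fin n → Fin n)
    (hT : 4 * k ^ 4 ≤ T.card)
    (hmono : (∀ y ∈ T, ∀ z ∈ T, u y < u z → v y < v z) ∨
      (∀ y ∈ T, ∀ z ∈ T, u y < u z → v z < v y))
    (hx : ∀ y ∈ T, u y < u x ∧ v x < v y ∧ v (s y) < v x)
    (hside : (∀ y ∈ T, u y < u (s y) ∧ ∀ z ∈ T, u y < u z → u (s y) < u z) ∨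
      (∀ y ∈ T, u (s y) < u y ∧ ∀ z ∈ T, u z < u y → u z < u (s y))) :
    (∃ σ : Equiv.Perm (Fin (2 * k)), IsParallelAlternation σ ∧ Contains π σ) ∨
      (∃ σ : Equiv.Perm (Fin (2 * k)), IsWedgeSimple σ ∧ Contains π σ) := by
  have hus : ∀ y ∈ T, ∀ z ∈ T, u y < u z → u (s y) < u (s z) := by
    intro y hy z hz hyz
    rcases hside with hside | hside
    · exact ((hside y hy).2 z hz hyz).trans (hside z hz).1
    · exact (hside y hy).1.trans ((hside z hz).2 y hy hyz)
  have hsinj : Set.InjOn (fun y => v (s y)) T := by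
    intro y hy z hz hyz
    have e := hf.injective_snd hyz
    rcases lt_trichotomy (u y) (u z) with h | h | h
    · exact absurd (hus y hy z hz h) (by rw [e]; exact lt_irrefl _)
    · exact hf.injective_fst h
    · exact absurd (hus z hz y hy h) (by rw [e]; exact lt_irrefl _)
  have hk1 : 1 ≤ 2 * k ^ 2 := by nlinarith
  have hcard : (2 * k ^ 2 - 1) * (2 * k ^ 2 - 1) < T.card := by
    have h1 : (2 * k ^ 2 - 1) * (2 * k ^ 2 - 1) < (2 * k ^ 2) * (2 * k ^ 2) :=
      Nat.mul_lt_mul'' (by omega) (by omega)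
    have h2 : (2 * k ^ 2) * (2 * k ^ 2) = 4 * k ^ 4 := by ring
    omega
  obtain ⟨T', hT', hcase⟩ := exists_monotone_subset u (fun y => v (s y)) _ _ T
    hf.injective_fst.injOn hsinj hcard
  have hT'card : T'.card = 2 * k ^ 2 := by
    rcases hcase with h | h
    · rw [h.1]; omega
    · rw [h.1]; omega
  have hb : (∀ y ∈ T', ∀ z ∈ T', u y < u z → v (s y) < v (s z)) ∨
      (∀ y ∈ T', ∀ z ∈ T', u y < u z → v (s z) < v (s y)) :=
    hcase.imp And.right And.right
  have : Nonempty (Fin n) := ⟨x⟩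
  obtain ⟨e, he, hlt⟩ := exists_enumeration u T' hf.injective_fst.injOn
  rw [hT'card] at he hlt
  have heT : ∀ i < 2 * k ^ 2, e i ∈ T := fun i hi => hT' (he i hi)
  rcases hside with hside | hside
  · refine exists_of_levels hπ hk hshort hf e (fun i => s (e i)) x (m := 2 * k ^ 2) (by omega)
      (fun i hi => (hside _ (heT i hi)).1)
      (fun i j hij hj => (hside _ (heT i (by omega))).2 _ (heT j hj) (hlt i j hij hj))
      (fun i hi => ⟨(hx _ (heT i hi)).1, (hx _ (heT i hi)).2.1⟩)
      (fun i hi => (hx _ (heT i hi)).2.2) ?_ ?_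
    · exact hmono.imp
        (fun h i j hij hj => h _ (heT i (by omega)) _ (heT j hj) (hlt i j hij hj))
        (fun h i j hij hj => h _ (heT i (by omega)) _ (heT j hj) (hlt i j hij hj))
    · exact hb.imp
        (fun h i j hij hj => h _ (he i (by omega)) _ (he j hj) (hlt i j hij hj))
        (fun h i j hij hj => h _ (he i (by omega)) _ (he j hj) (hlt i j hij hj))
  -- When partners lie on the left, each point is paired with the partner of the next point, at the
  -- cost of one level.
  · refine exists_of_levels hπ hk hshort hf e (fun i => s (e (i + 1))) x (m := 2 * k ^ 2 - 1)
      (by omega)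
      (fun i hi => (hside _ (heT (i + 1) (by omega))).2 _ (heT i (by omega))
        (hlt i (i + 1) (by omega) (by omega)))
      (fun i j hij hj => ?_)
      (fun i hi => ⟨(hx _ (heT i (by omega))).1, (hx _ (heT i (by omega))).2.1⟩)
      (fun i hi => (hx _ (heT (i + 1) (by omega))).2.2) ?_ ?_
    · have h1 := (hside _ (heT (i + 1) (by omega))).1
      rcases Nat.lt_or_ge (i + 1) j with h2 | h2
      · exact h1.trans (hlt _ _ h2 (by omega))
      · have h3 : j = i + 1 := by omega
        rwa [h3]
    · exact hmono.imp
        (fun h i j hij hj => h _ (heT i (by omega)) _ (heT j (by omega)) (hlt i j hij (by omega)))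
        (fun h i j hij hj => h _ (heT i (by omega)) _ (heT j (by omega)) (hlt i j hij (by omega)))
    · exact hb.imp
        (fun h i j hij hj => h _ (he (i + 1) (by omega)) _ (he (j + 1) (by omega))
          (hlt (i + 1) (j + 1) (by omega) (by omega)))
        (fun h i j hij hj => h _ (he (i + 1) (by omega)) _ (he (j + 1) (by omega))
          (hlt (i + 1) (j + 1) (by omega) (by omega)))

end Core

/-! ### Convergence of proper pin sequences -/

section Convergence

variable {n k : ℕ} {π : Equiv.Perm (Fin n)} {u v : Fin n → ℤ}

/-- In a frame, one of the coordinates changes by the same sign between adjacent positions. -/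
theorem IsFrame.exists_step (h : IsFrame π u v) :
    ∃ δ : ℤ, (δ = 1 ∨ δ = -1) ∧ ((∀ i j : Fin n, (j : ℕ) = i + 1 → u j = u i + δ) ∨
      (∀ i j : Fin n, (j : ℕ) = i + 1 → v j = v i + δ)) := by
  have key : ∀ s, ∃ δ : ℤ, (δ = 1 ∨ δ = -1) ∧
      ∀ i j : Fin n, (j : ℕ) = i + 1 → signed s (coord π true) j = signed s (coord π true) i + δ := by
    intro s
    cases s
    · refine ⟨-1, Or.inr rfl, fun i j hij => ?_⟩
      simp only [signed, coord, hij, if_true, if_false, Bool.false_eq_true]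
      push_cast
      ring
    · refine ⟨1, Or.inl rfl, fun i j hij => ?_⟩
      simp [signed, coord, hij]
  obtain ⟨⟨b, s, t⟩, rfl, rfl⟩ := h.exists_code
  cases b
  · obtain ⟨δ, h1, h2⟩ := key t
    exact ⟨δ, h1, Or.inr h2⟩
  · obtain ⟨δ, h1, h2⟩ := key s
    exact ⟨δ, h1, Or.inl h2⟩

/-- What precedes a separating pin: an adjacent entry, or a set that the preceding entry, the
highest above it, splits. -/
theorem IsRightProperPin.partner (hf : IsFrame π u v) {x y i j : Fin n} {S : List (Fin n)}
    (hS : IsProperPinList π i j (y :: S)) (hx : IsRightProperPin u v x y S) :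
    (y = j ∧ v i < v x) ∨ ∃ l r, u l < u y ∧ u y < u r ∧ v l < v x ∧ v r < v x ∧
      ∀ q, u l ≤ u q → u q ≤ u r → v q ≤ v y := by
  obtain ⟨-, hxy, hSx, -⟩ := hx
  cases hS with
  | base => exact Or.inl ⟨rfl, (hSx i (by simp)).2⟩
  | cons hf' hy hne _ =>
    right
    rename_i z S' u' v'
    obtain ⟨⟨a, ha, b, hb, h1, h2⟩, h3, h4⟩ := hy.isRightMaxPin hne
    have hva := (hSx a ha).2
    have hvb := (hSx b hb).2
    have hua := h3 a ha
    -- As y lies above all of S, it must have been an upward pin: it cuts S horizontally and is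
    -- highest over that extent.
    rcases hf.comparable hf' with ⟨-, rfl | rfl⟩ | ⟨rfl | rfl, rfl | rfl⟩
    · exact absurd h2 (by linarith)
    · simp only at h1
      exact absurd h1 (by linarith)
    · exact ⟨a, b, h1, h2, hva, hvb, fun q h5 h6 => h4 q ⟨a, ha, b, hb, h5, h6⟩⟩
    · exact ⟨b, a, neg_lt_neg_iff.1 h2, neg_lt_neg_iff.1 h1, hvb, hva,
        fun q h5 h6 => h4 q ⟨a, ha, b, hb, neg_le_neg h6, neg_le_neg h5⟩⟩
    · simp only at hua
      exact absurd hua (by linarith)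
    · simp only at hua
      exact absurd hua (by linarith)

/-- Many proper pin sequences that reach the same entry from different ones. -/
theorem exists_of_convergence (hπ : IsSimple π) (hk : 2 ≤ k)
    (hshort : ∀ p₁ p₂ l, p₁ ≠ p₂ → IsProperPinList π p₁ p₂ l → l.length < 2 * k)
    (hf : IsFrame π u v) (x : Fin n) (J : Finset (Fin n)) (hJ : 32 * k ^ 8 ≤ J.card)
    (hx : ∀ y ∈ J, ∃ (i j : Fin n) (S : List (Fin n)), (j : ℕ) = i + 1 ∧
      IsProperPinList π i j (y :: S) ∧ IsRightProperPin u v x y S) :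
    (∃ σ : Equiv.Perm (Fin (2 * k)), IsParallelAlternation σ ∧ Contains π σ) ∨
      (∃ σ : Equiv.Perm (Fin (2 * k)), IsWedgeSimple σ ∧ Contains π σ) := by
  classical
  have hux : ∀ y ∈ J, u y < u x ∧ v x < v y := by
    intro y hy
    obtain ⟨i, j, S, -, -, h⟩ := hx y hy
    exact ⟨h.1, h.2.1⟩
  let P : Fin n → Prop := fun y => ∃ l r, u l < u y ∧ u y < u r ∧ v l < v x ∧ v r < v x ∧
    ∀ q, u l ≤ u q → u q ≤ u r → v q ≤ v y
  have hmonotone : ∀ K ⊆ J, 16 * k ^ 8 ≤ K.card → ∃ T ⊆ K, 4 * k ^ 4 ≤ T.card ∧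
      ((∀ y ∈ T, ∀ z ∈ T, u y < u z → v y < v z) ∨
        (∀ y ∈ T, ∀ z ∈ T, u y < u z → v z < v y)) := by
    intro K hK hcard
    have hk1 : 1 ≤ 4 * k ^ 4 := by
      have : 1 ≤ k ^ 4 := Nat.one_le_pow _ _ (by omega)
      omega
    have hlt : (4 * k ^ 4 - 1) * (4 * k ^ 4 - 1) < K.card := by
      have h1 : (4 * k ^ 4 - 1) * (4 * k ^ 4 - 1) < (4 * k ^ 4) * (4 * k ^ 4) :=
        Nat.mul_lt_mul'' (by omega) (by omega)
      have h2 : (4 * k ^ 4) * (4 * k ^ 4) = 16 * k ^ 8 := by ring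
      omega
    obtain ⟨T, hT, h | h⟩ := exists_monotone_subset u v _ _ K hf.injective_fst.injOn
      hf.injective_snd.injOn hlt
    · exact ⟨T, hT, by omega, Or.inl h.2⟩
    · exact ⟨T, hT, by omega, Or.inr h.2⟩
  have hsplit : (J.filter P).card + (J.filter fun y => ¬P y).card = J.card :=
    Finset.card_filter_add_card_filter_not P
  by_cases hP : 16 * k ^ 8 ≤ (J.filter P).card
  · obtain ⟨T, hT, hcard, hmono⟩ := hmonotone _ (Finset.filter_subset _ _) hP
    have hTJ : ∀ y ∈ T, y ∈ J ∧ P y := fun y hy => Finset.mem_filter.1 (hT hy)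
    have hPT : ∀ y, ∃ l r, y ∈ T → u l < u y ∧ u y < u r ∧ v l < v x ∧ v r < v x ∧
        ∀ q, u l ≤ u q → u q ≤ u r → v q ≤ v y := by
      intro y
      by_cases hy : y ∈ T
      · obtain ⟨l, r, h⟩ := (hTJ y hy).2
        exact ⟨l, r, fun _ => h⟩
      · exact ⟨y, y, fun h => absurd h hy⟩
    choose l r hlr using hPT
    rcases hmono with hmono | hmono
    -- In an increasing T the next point is higher than y, so it lies beyond r; in a decreasing T, l
    -- plays this part on the left.
    · refine exists_of_partners hπ hk hshort hf x T r hcard (Or.inl hmono)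
        (fun y hy => ⟨(hux y (hTJ y hy).1).1, (hux y (hTJ y hy).1).2, (hlr y hy).2.2.2.1⟩)
        (Or.inl fun y hy => ⟨(hlr y hy).2.1, fun z hz hyz => ?_⟩)
      by_contra hcon
      have h1 := (hlr y hy).2.2.2.2 z ((hlr y hy).1.trans hyz).le (not_lt.1 hcon)
      exact absurd (hmono y hy z hz hyz) (not_lt.2 h1)
    · refine exists_of_partners hπ hk hshort hf x T l hcard (Or.inr hmono)
        (fun y hy => ⟨(hux y (hTJ y hy).1).1, (hux y (hTJ y hy).1).2, (hlr y hy).2.2.1⟩)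
        (Or.inr fun y hy => ⟨(hlr y hy).1, fun z hz hzy => ?_⟩)
      by_contra hcon
      have h1 := (hlr y hy).2.2.2.2 z (not_lt.1 hcon) (hzy.trans (hlr y hy).2.1).le
      exact absurd (hmono z hz y hy hzy) (not_lt.2 h1)
  · obtain ⟨T, hT, hcard, hmono⟩ := hmonotone _ (Finset.filter_subset (fun y => ¬P y) J) (by omega)
    have hTJ : ∀ y ∈ T, y ∈ J ∧ ¬P y := fun y hy => Finset.mem_filter.1 (hT hy)
    have hadj : ∀ y, ∃ i : Fin n, y ∈ T → (y : ℕ) = i + 1 ∧ v i < v x := by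
      intro y
      by_cases hy : y ∈ T
      · obtain ⟨i, j, S, hij, hS, h⟩ := hx y (hTJ y hy).1
        rcases h.partner hf hS with ⟨rfl, h1⟩ | h1
        · exact ⟨i, fun _ => ⟨hij, h1⟩⟩
        · exact absurd h1 (hTJ y hy).2
      · exact ⟨y, fun h => absurd h hy⟩
    choose s hs using hadj
    have hsx : ∀ y ∈ T, u y < u x ∧ v x < v y ∧ v (s y) < v x := fun y hy =>
      ⟨(hux y (hTJ y hy).1).1, (hux y (hTJ y hy).1).2, (hs y hy).2⟩
    have hne : ∀ y ∈ T, ∀ z ∈ T, u z ≠ u (s y) := by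
      intro y hy z hz e
      have h1 := (hsx y hy).2.2
      have h2 := (hsx z hz).2.1
      rw [hf.injective_fst e] at h2
      exact lt_asymm h1 h2
    -- Positions must be read by u: otherwise y and its partner would have consecutive
    -- v-coordinates, yet x lies strictly between them.
    obtain ⟨δ, hδ, hstep | hstep⟩ := hf.exists_step
    · refine exists_of_partners hπ hk hshort hf x T s hcard hmono hsx ?_
      rcases hδ with rfl | rfl
      · right
        intro y hy
        have h1 := hstep _ _ (hs y hy).1
        refine ⟨by omega, fun z hz hzy => ?_⟩
        have := hne y hy z hz
        omega
      · left
        intro y hy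
        have h1 := hstep _ _ (hs y hy).1
        refine ⟨by omega, fun z hz hzy => ?_⟩
        have := hne y hy z hz
        omega
    · exfalso
      have hpos : 0 < T.card := by
        have : 1 ≤ k ^ 4 := Nat.one_le_pow _ _ (by omega)
        omega
      obtain ⟨y, hy⟩ := Finset.card_pos.1 hpos
      have h1 := hstep _ _ (hs y hy).1
      obtain ⟨-, h2, h3⟩ := hsx y hy
      omega

/-- The entries that precede `x` in some proper pin sequence starting at adjacent positions. -/
def IsPredecessor (π : Equiv.Perm (Fin n)) (x y : Fin n) : Prop :=
  ∃ (i j : Fin n) (S : List (Fin n)), (j : ℕ) = i + 1 ∧ IsProperPinList π i j (x :: y :: S)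

open Classical in
/-- The entries from which `w` is reached in at most `d` steps to the next pin. -/
noncomputable def predecessors (π : Equiv.Perm (Fin n)) (w : Fin n) : ℕ → Finset (Fin n)
  | 0 => {w}
  | d + 1 => predecessors π w d ∪
      (predecessors π w d).biUnion fun x => Finset.univ.filter (IsPredecessor π x)

theorem predecessors_mono (w : Fin n) {d e : ℕ} (h : d ≤ e) :
    predecessors π w d ⊆ predecessors π w e := by
  induction h with
  | refl => exact subset_rfl
  | step _ ih => exact ih.trans Finset.subset_union_left

open Classical in
theorem card_predecessors_le (w : Fin n) {B : ℕ}
    (hB : ∀ x, (Finset.univ.filter (IsPredecessor π x)).card < B) (d : ℕ) :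
    (predecessors π w d).card ≤ B ^ d := by
  induction d with
  | zero => simp [predecessors]
  | succ d ih =>
    have hB1 : 1 ≤ B := by have := hB w; omega
    calc (predecessors π w (d + 1)).card
        ≤ (predecessors π w d).card + (predecessors π w d).card * (B - 1) :=
          (Finset.card_union_le _ _).trans (Nat.add_le_add_left
            (Finset.card_biUnion_le_card_mul _ _ _ fun x _ => by have := hB x; omega) _)
      _ = (predecessors π w d).card * B := by
          obtain ⟨c, rfl⟩ : ∃ c, B = c + 1 := ⟨B - 1, by omega⟩
          simp only [Nat.add_sub_cancel]
          ring
      _ ≤ B ^ d * B := Nat.mul_le_mul_right _ ih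
      _ = B ^ (d + 1) := (pow_succ _ _).symm

/-- Tails of a proper list of length at least two are proper lists with the same start, so each step
down the list is one predecessor step. -/
theorem IsProperPinList.subset_predecessors {i j : Fin n} (hij : (j : ℕ) = i + 1) (w : Fin n) :
    ∀ (S : List (Fin n)) (x : Fin n) (d : ℕ), IsProperPinList π i j (x :: S) →
      x ∈ predecessors π w d → ∀ q ∈ x :: S, q ∈ predecessors π w (d + S.length) := by
  classical
  have hstep : ∀ x y S d, IsProperPinList π i j (x :: y :: S) → x ∈ predecessors π w d →
      y ∈ predecessors π w (d + 1) := by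
    intro x y S d hl hx
    refine Finset.mem_union_right _ (Finset.mem_biUnion.2 ⟨x, hx, ?_⟩)
    exact Finset.mem_filter.2 ⟨Finset.mem_univ _, i, j, S, hij, hl⟩
  intro S
  induction S with
  | nil =>
    intro x d _ hx q hq
    rw [List.mem_singleton] at hq
    subst hq
    simpa using hx
  | cons y S ih =>
    intro x d hl hx q hq
    rcases List.mem_cons.1 hq with rfl | hq'
    · exact predecessors_mono w (Nat.le_add_right _ _) hx
    · have hy := hstep x y S d hl hx
      cases hl with
      | base =>
        rw [List.mem_singleton] at hq'
        subst hq'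
        exact hy
      | cons _ _ _ hl' =>
        have := ih y (d + 1) hl' hy q hq'
        rwa [List.length_cons, Nat.add_comm S.length 1, ← Nat.add_assoc]

theorem IsProperPinList.mem_fst {i j : Fin n} {l : List (Fin n)}
    (hl : IsProperPinList π i j l) : i ∈ l := by
  induction hl with
  | base => simp
  | cons _ _ _ _ ih => simp [ih]

open Classical in
/-- Some entry is reached from many others. -/
theorem exists_many_predecessors (hπ : IsSimple π) (hk : 2 ≤ k)
    (hshort : ∀ p₁ p₂ l, p₁ ≠ p₂ → IsProperPinList π p₁ p₂ l → l.length < 2 * k) {B : ℕ}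
    (hB : 2 ≤ B) (hn : 2 * B ^ (2 * k) ≤ n) :
    ∃ x, B ≤ (Finset.univ.filter (IsPredecessor π x)).card := by
  by_contra hcon
  push Not at hcon
  have hpow : 1 ≤ B ^ (2 * k) := Nat.one_le_pow _ _ (by omega)
  let w : Fin n := ⟨n - 1, by omega⟩
  -- Every entry except the rightmost starts a proper pin sequence together with its right
  -- neighbour.
  have hall : Finset.univ.erase w ⊆ predecessors π w (2 * k) := by
    intro i hi
    have hiw : i ≠ w := (Finset.mem_erase.1 hi).1
    have hin : (i : ℕ) + 1 < n := by
      have h1 : (i : ℕ) ≠ n - 1 := fun e => hiw (Fin.ext e)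
      omega
    let j : Fin n := ⟨i + 1, hin⟩
    have hij : i ≠ j := fun e => by
      have := congrArg Fin.val e
      simp [j] at this
    obtain ⟨S, hS⟩ := exists_isProperPinList hπ hij IsFrame.base (w := w) (by
      intro q
      have : (q : ℕ) ≤ n - 1 := by omega
      simp only [w]
      exact_mod_cast this) hiw.symm
    have hlen := hshort _ _ _ hij hS
    rw [List.length_cons] at hlen
    have := IsProperPinList.subset_predecessors rfl w S w 0 hS (by simp [predecessors]) i hS.mem_fst
    exact predecessors_mono w (by omega) this
  have h1 := (Finset.card_le_card hall).trans (card_predecessors_le w hcon (2 * k))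
  rw [Finset.card_erase_of_mem (Finset.mem_univ _), Finset.card_univ, Fintype.card_fin] at h1
  have h2 : 2 ≤ B ^ (2 * k) := by
    calc 2 ≤ B := hB
      _ = B ^ 1 := (pow_one _).symm
      _ ≤ B ^ (2 * k) := Nat.pow_le_pow_right (by omega) (by omega)
  omega

theorem exists_of_short (hπ : IsSimple π) (hk : 2 ≤ k)
    (hshort : ∀ p₁ p₂ l, p₁ ≠ p₂ → IsProperPinList π p₁ p₂ l → l.length < 2 * k)
    (hn : 2 * (256 * k ^ 8) ^ (2 * k) ≤ n) :
    (∃ σ : Equiv.Perm (Fin (2 * k)), IsParallelAlternation σ ∧ Contains π σ) ∨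
      (∃ σ : Equiv.Perm (Fin (2 * k)), IsWedgeSimple σ ∧ Contains π σ) := by
  classical
  have hk8 : 1 ≤ k ^ 8 := Nat.one_le_pow _ _ (by omega)
  obtain ⟨x, hx⟩ := exists_many_predecessors hπ hk hshort (by omega) hn
  let Q : Bool × Bool × Bool → Fin n → Prop := fun c y =>
    ∃ (i j : Fin n) (S : List (Fin n)), (j : ℕ) = i + 1 ∧ IsProperPinList π i j (y :: S) ∧
      IsRightProperPin (frameFst π c) (frameSnd π c) x y S
  let J : Finset (Fin n) := Finset.univ.filter fun y => ∃ c, Q c y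
  -- The exceptional predecessor comes from a two-point list, where y is the left neighbour of x.
  have hrest : (Finset.univ.filter (IsPredecessor π x)).card ≤ J.card + 1 := by
    have hsub : Finset.univ.filter (IsPredecessor π x) ⊆
        J ∪ Finset.univ.filter fun y : Fin n => (x : ℕ) = y + 1 := by
      intro y hy
      obtain ⟨i, j, S, hij, hl⟩ := (Finset.mem_filter.1 hy).2
      cases hl with
      | base => exact Finset.mem_union_right _ (by simpa using hij)
      | cons hf hpin hS hl =>
        obtain ⟨c, rfl, rfl⟩ := hf.exists_code
        exact Finset.mem_union_left _ (Finset.mem_filter.2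
          ⟨Finset.mem_univ _, c, i, j, S, hij, hl, hpin⟩)
    have hone : (Finset.univ.filter fun y : Fin n => (x : ℕ) = y + 1).card ≤ 1 := by
      rw [Finset.card_le_one]
      intro y hy z hz
      have h1 := (Finset.mem_filter.1 hy).2
      have h2 := (Finset.mem_filter.1 hz).2
      exact Fin.ext (by omega)
    exact (Finset.card_le_card hsub).trans ((Finset.card_union_le _ _).trans (by omega))
  have hQ : ∀ y, ∃ c, y ∈ J → Q c y := by
    intro y
    by_cases hy : y ∈ J
    · obtain ⟨c, hc⟩ := (Finset.mem_filter.1 hy).2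
      exact ⟨c, fun _ => hc⟩
    · exact ⟨(true, true, true), fun h => absurd h hy⟩
  choose c hc using hQ
  -- Pigeonhole over the eight frames: 8(32k^8 - 1) < 256k^8 - 1.
  obtain ⟨c₀, -, hc₀⟩ := Finset.exists_lt_card_fiber_of_mul_lt_card_of_maps_to
    (s := J) (t := Finset.univ) (f := c) (n := 32 * k ^ 8 - 1) (fun _ _ => Finset.mem_univ _) (by
      simp only [Finset.card_univ, Fintype.card_prod, Fintype.card_bool]
      omega)
  refine exists_of_convergence hπ hk hshort (isFrame_code π c₀) x (J.filter fun y => c y = c₀)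
    (by omega) fun y hy => ?_
  obtain ⟨hyJ, hyc⟩ := Finset.mem_filter.1 hy
  exact hyc ▸ hc y hyJ

end Convergence

end SimplePerm

theorem mainTheorem6 (k n : ℕ) (π : Equiv.Perm (Fin n)) (hπ : SimplePerm.IsSimple π)
    (hn : 2 * (256 * k ^ 8) ^ (2 * k) ≤ n) :
    (∃ p : Fin (2 * k) → Fin n × Fin n, SimplePerm.IsProperPinSequence π p) ∨
    (∃ σ : Equiv.Perm (Fin (2 * k)),
      SimplePerm.IsParallelAlternation σ ∧ SimplePerm.Contains π σ) ∨
    (∃ σ : Equiv.Perm (Fin (2 * k)),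
      SimplePerm.IsWedgeSimple σ ∧ SimplePerm.Contains π σ) := by
  by_cases hshort : ∀ p₁ p₂ l, p₁ ≠ p₂ → SimplePerm.IsProperPinList π p₁ p₂ l → l.length < 2 * k
  · right
    have hn2 : 2 ≤ n := by
      rcases Nat.eq_zero_or_pos k with rfl | hk
      · simpa using hn
      · have : 1 ≤ (256 * k ^ 8) ^ (2 * k) := Nat.one_le_pow _ _ (by positivity)
        omega
    -- Any two points form a proper list, so shortness forces k ≥ 2.
    have hbase := hshort ⟨0, by omega⟩ ⟨1, by omega⟩ _ (by simp) .base
    rw [List.length_cons, List.length_singleton] at hbase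
    exact SimplePerm.exists_of_short hπ (by omega) hshort hn
  · left
    push Not at hshort
    obtain ⟨p₁, p₂, l, hp, hl, hlen⟩ := hshort
    exact hl.exists_sequence hp hlen
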